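/- Theorem 6. For $N\ge 1$ let $\mathcal T_N$ be the finite set of rooted planar trees with $N$ edges whose root $r$ has degree $1$, and let $\bar\mu_N$ be the probability measure on $\mathcal T_N$ with $\bar\mu_N(T)=Z_N^{-1}\prod_{v\ne r}p_{\sigma_v-1}$, where $p_n=2^{-(n+1)}$, $\sigma_v$ is the degree of $v$ and $Z_N$ is the normalising constant. As $N\to\infty$ the measures $\bar\mu_N$ converge weakly, with respect to the local metric $d(T,T')=\inf\{1/R: B_R(T)=B_R(T')\}$ on locally finite rooted planar trees, where $B_R$ denotes the ball of radius $R$ around the root, to a unique probability measure $\bar\mu$ (the uniform infinite planar tree), which is concentrated on infinite trees. To an infinite tree $T$ there corresponds an infinite causal triangulation $G=\beta^{-1}(T)$: its vertices are the vertices of $T$ other than $r$; the set $S_k$ of the vertices at height $k+1$ in $T$ is, for $k\ge1$, joined into a cycle in the left-to-right order of the planar tree; $S_0$ is the root of $G$; all edges of $T$ not incident to $r$ are kept; and each vertex of $S_k$, $k\ge 1$, is joined by one additional edge, placed after the edges to its children, to the vertex of $S_{k+1}$ that comes next in the cyclic order. The uniform infinite causal triangulation is $G=\beta^{-1}(T)$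 with $T$ distributed according to $\bar\mu$. Let $\mathcal R$ be the set of multigraphs on $\{0,1,2,\dots\}$, rooted at $0$, in which $n$ and $n+1$ are joined by $L_n\ge 1$ edges for every $n\ge0$, and which have no other edges. Let $\chi_{\mathrm R}$ be the law on $\mathcal R$ of the graph obtained from the uniform infinite causal triangulation by identifying, for every $k$, all vertices of $S_k$ and deleting the edges in $S_k$, while keeping all edges between $S_k$ and $S_{k+1}$; and let $\chi_{\mathrm R'}$ be the law of the graph obtained in the same way when only those edges between $S_k$ and $S_{k+1}$ are kept that belong to the tree $T$. For $G\in\mathcal R$ let $p_G(t)$ be the probability that simple random walk on $G$ started at $0$ is at $0$ at time $t$, and let $Q_G(x)=1+\sum_{t\ge1}(1-x)^{t/2}p_G(t)$ for $0<x<1$. The spectral dimension of $G$ is $d_s=2-2\alpha$ with $\alpha=\lim_{x\to0^+}\frac{\log Q_G(x)}{|\log x|}$, provided that this limit exists. The annealed spectral dimension $d_s^{ann}$ of an ensemble $(\mathcal R,\chi)$ is defined in the same way, with $Q_G(x)$ replaced by its expectation with respect to $\chi$. Then, for each of the ensembles $(\mathcal R,\chi_{\mathrm R})$ and $(\mathcal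 R,\chi_{\mathrm R'})$, the expectation of $Q_G(x)$ is finite for $0<x<1$, and the annealed spectral dimension exists and satisfies $d_s^{ann}=2$. Moreover, if the spectral dimension $d_s$ of $G$ exists almost surely, then $d_s=2$ almost surely. -/

import Mathlib

open MeasureTheory Filter Topology
open scoped ENNReal BoundedContinuousFunction

/-! ### Planar trees -/

/-- Locally finite rooted planar trees (finite or infinite), up to isomorphism, whose root `r` has
exactly one neighbour. The vertices at height `k + 1` are listed from left to right, and
`offspring k` is the list of their numbers of children, so that `offspring k` has one entry for
each vertex at height `k + 1`; the children of consecutive vertices are consecutive. -/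
@[ext]
structure PlanarTree where
  offspring : ℕ → List ℕ
  length_zero : (offspring 0).length = 1
  length_succ : ∀ k, (offspring (k + 1)).length = (offspring k).sum

namespace PlanarTree

/-- The vertices different from the root `r`: `(k, i)` is the `i`-th vertex (counted from `0`) at
height `k + 1`. They correspond to the edges, by sending a vertex to the edge to its parent. -/
def vertices (T : PlanarTree) : Set (ℕ × ℕ) := {v | v.2 < (T.offspring v.1).length}

/-- The number of children of the vertex `v = (k, i)`, that is, its degree minus one. -/
def children (T : PlanarTree) (v : ℕ × ℕ) : ℕ := (T.offspring v.1).getD v.2 0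

/-- The trees with `N` edges. -/
def withEdges (N : ℕ) : Set PlanarTree := {T | T.vertices.encard = N}

/-- The balls of radius `R` around the roots of `T` and `T'` coincide (the children of a vertex at
height `k + 1` belong to this ball if and only if `k + 2 ≤ R`). -/
def SameBall (R : ℕ) (T T' : PlanarTree) : Prop :=
  ∀ k, k + 2 ≤ R → T.offspring k = T'.offspring k

/-- The topology of the metric `d(T, T') = inf {1 / R | B_R(T) = B_R(T')}`. -/
instance : TopologicalSpace PlanarTree :=
  TopologicalSpace.generateFrom {U | ∃ R T, U = {T' | SameBall R T T'}}

instance : MeasurableSpace PlanarTree := borel PlanarTree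

instance : BorelSpace PlanarTree := ⟨rfl⟩

/-- The offspring probabilities `p_n = 2 ^ (-(n + 1))`. -/
noncomputable def offspringProb (n : ℕ) : ℝ≥0∞ := (2⁻¹ : ℝ≥0∞) ^ (n + 1)

/-- The Galton-Watson weight of a finite tree: the product of `p_(σ_v - 1)` over all vertices `v`
other than the root, where `σ_v` is the degree of `v`. -/
noncomputable def weight (T : PlanarTree) : ℝ≥0∞ :=
  ∏ᶠ v ∈ T.vertices, offspringProb (T.children v)

/-- The Galton-Watson tree conditioned to have `N` edges (for `N ≥ 1`). -/
noncomputable def conditionedGW (N : ℕ) : Measure PlanarTree :=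
  (∑' T : withEdges N, weight T)⁻¹ •
    Measure.sum (fun T : withEdges N => weight T • Measure.dirac (T : PlanarTree))

/-- `μ` is the law of the uniform infinite planar tree: the weak limit of the conditioned
Galton-Watson trees with `N` edges as `N → ∞`. -/
def IsUniformInfinitePlanarTree (μ : Measure PlanarTree) : Prop :=
  IsProbabilityMeasure μ ∧
    ∀ f : PlanarTree →ᵇ ℝ,
      Tendsto (fun N => ∫ T, f T ∂(conditionedGW N)) atTop (𝓝 (∫ T, f T ∂μ))

/-! ### The causal triangulation of a planar tree -/

/-- Labels of edges of causal triangulations. `circle k i` is the edge of the cycle `S_k` that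
leaves the `i`-th vertex of `S_k`; `up k i j` is the `j`-th edge from the `i`-th vertex of `S_k`
to `S_(k + 1)`. -/
inductive CTEdge where
  | circle (k i : ℕ)
  | up (k i j : ℕ)

/-- The edges of the causal triangulation of an infinite tree `T`. Its vertices are the vertices of
`T` other than `r`, with `S_k` the set of vertices at height `k + 1` in `T`, and `S_0` its root.
For `k ≥ 1` the vertices of `S_k` form a cycle. Besides its edges to its children, a vertex
of `S_k` with `k ≥ 1` has one more edge to `S_(k + 1)`, the last one. -/
def ctEdges (T : PlanarTree) : Set CTEdge :=
  {e | match e with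
    | .circle k i => (k, i) ∈ T.vertices ∧ 1 ≤ k
    | .up k i j => (k, i) ∈ T.vertices ∧
        (j < T.children (k, i) ∨ (j = T.children (k, i) ∧ 1 ≤ k))}

/-- The endpoints of an edge. The edges from the `i`-th vertex of `S_k` to `S_(k + 1)` go to its
children from left to right and then, for the last one, to the vertex that follows them in the
cyclic order of `S_(k + 1)` (the next place, if it has no child). -/
def ctEnds (T : PlanarTree) : CTEdge → Sym2 (ℕ × ℕ)
  | .circle k i => s((k, i), (k, (i + 1) % (T.offspring k).length))
  | .up k i j =>
      s((k, i), (k + 1, (((T.offspring k).take i).sum + j) % (T.offspring (k + 1)).length))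

/-- The edges of the causal triangulation that belong to the tree `T`. -/
def ctTreeEdges (T : PlanarTree) : Set CTEdge :=
  {e | match e with
    | .circle _ _ => False
    | .up k i j => (k, i) ∈ T.vertices ∧ j < T.children (k, i)}

/-- The edges between `S_k` and `S_(k + 1)` (the first coordinate of a vertex is its height). -/
def slice (T : PlanarTree) (k : ℕ) : Set CTEdge :=
  {e | e ∈ T.ctEdges ∧ (T.ctEnds e).map Prod.fst = s(k, k + 1)}

/-- The edges between `S_k` and `S_(k + 1)` that belong to the tree. -/
def treeSlice (T : PlanarTree) (k : ℕ) : Set CTEdge :=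
  {e | e ∈ T.ctTreeEdges ∧ (T.ctEnds e).map Prod.fst = s(k, k + 1)}

theorem length_eq_sum (T : PlanarTree) (k : ℕ) :
    ∑ i ∈ Finset.range (T.offspring k).length, T.children (k, i)
      = (T.offspring (k + 1)).length := by
  rw [T.length_succ, Finset.sum_range]
  simp [children]

theorem ncard_aux (k l : ℕ) (f : ℕ → ℕ) (S : Set CTEdge)
    (hS : S = {e | ∃ i j, e = .up k i j ∧ i < l ∧ j < f i}) :
    S.ncard = ∑ i ∈ Finset.range l, f i := by
  have h : S = (fun p : (_ : ℕ) × ℕ => CTEdge.up k p.1 p.2) ''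
      (((Finset.range l).sigma fun i => Finset.range (f i) : Finset _) : Set _) := by
    subst hS
    ext e
    constructor
    · rintro ⟨i, j, rfl, hi, hj⟩
      exact ⟨⟨i, j⟩, by simp [hi, hj], rfl⟩
    · rintro ⟨⟨i, j⟩, hp, rfl⟩
      simp at hp
      exact ⟨i, j, rfl, hp.1, hp.2⟩
  rw [h, Set.ncard_image_of_injective, Set.ncard_coe_finset, Finset.card_sigma]
  · simp
  · rintro ⟨i, j⟩ ⟨i', j'⟩ h
    simp at h
    obtain ⟨rfl, rfl⟩ := h
    rfl

theorem ends_iff (T : PlanarTree) (k k' i j : ℕ) :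
    (T.ctEnds (.up k' i j)).map Prod.fst = s(k, k + 1) ↔ k' = k := by
  simp only [ctEnds, Sym2.map_mk, Sym2.eq_iff]
  omega

theorem ends_circle (T : PlanarTree) (k k' i : ℕ) :
    ¬ (T.ctEnds (.circle k' i)).map Prod.fst = s(k, k + 1) := by
  simp only [ctEnds, Sym2.map_mk, Sym2.eq_iff]
  omega

/-- The number of tree edges between `S_k` and `S_(k + 1)` is `|S_(k + 1)|`. -/
theorem ncard_treeSlice (T : PlanarTree) (k : ℕ) :
    (T.treeSlice k).ncard = (T.offspring (k + 1)).length := by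
  rw [← length_eq_sum]
  apply ncard_aux k
  ext e
  cases e with
  | circle k' i => simp [treeSlice, ends_circle]
  | up k' i j =>
    simp only [treeSlice, ctTreeEdges, vertices, Set.mem_ofPred_eq, ends_iff, CTEdge.up.injEq]
    constructor
    · rintro ⟨⟨h1, h2⟩, rfl⟩
      exact ⟨i, j, ⟨rfl, rfl, rfl⟩, h1, h2⟩
    · rintro ⟨_, _, ⟨rfl, rfl, rfl⟩, h1, h2⟩
      exact ⟨⟨h1, h2⟩, rfl⟩

/-- The number of edges between `S_k` and `S_(k + 1)` is `|S_k| + |S_(k + 1)|`, where `|S_0|`,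
the number of edges in `S_0`, is `0`. -/
theorem ncard_slice (T : PlanarTree) (k : ℕ) :
    (T.slice k).ncard
      = (if k = 0 then 0 else (T.offspring k).length) + (T.offspring (k + 1)).length := by
  have h : (if k = 0 then 0 else (T.offspring k).length) + (T.offspring (k + 1)).length
      = ∑ i ∈ Finset.range (T.offspring k).length,
          (T.children (k, i) + if k = 0 then 0 else 1) := by
    rw [← length_eq_sum, Finset.sum_add_distrib, add_comm]
    split_ifs <;> simp
  rw [h]
  apply ncard_aux k
  ext e
  cases e with
  | circle k' i => simp [slice, ends_circle]
  | up k' i j =>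
    simp only [slice, ctEdges, vertices, Set.mem_ofPred_eq, ends_iff, CTEdge.up.injEq]
    constructor
    · rintro ⟨⟨h1, h2⟩, rfl⟩
      refine ⟨i, j, ⟨rfl, rfl, rfl⟩, h1, ?_⟩
      split_ifs <;> omega
    · rintro ⟨_, _, ⟨rfl, rfl, rfl⟩, h1, h2⟩
      refine ⟨⟨h1, ?_⟩, rfl⟩
      split_ifs at h2 <;> omega

/-- An infinite (locally finite) tree has vertices at every height. -/
theorem length_pos (T : PlanarTree) (hT : T.vertices.Infinite) (k : ℕ) :
    0 < (T.offspring k).length := by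
  by_contra h
  apply hT
  have hz : ∀ m, k ≤ m → (T.offspring m).length = 0 := by
    intro m hm
    induction m, hm using Nat.le_induction with
    | base => omega
    | succ m _ ih =>
      rw [T.length_succ, List.eq_nil_of_length_eq_zero ih]
      rfl
  have hsub : T.vertices ⊆ ((Finset.range k).biUnion fun m =>
      (Finset.range (T.offspring m).length).image fun i => (m, i) : Finset (ℕ × ℕ)) := by
    rintro ⟨m, i⟩ hv
    simp only [vertices, Set.mem_ofPred_eq] at hv
    have : m < k := by
      by_contra hmk
      have := hz m (by omega)
      omega
    simp [this, hv]
  exact (Finset.finite_toSet _).subset hsub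

end PlanarTree

/-- The infinite planar trees, equivalently the infinite causal triangulations. -/
abbrev InfinitePlanarTree : Type := {T : PlanarTree // T.vertices.Infinite}

/-! ### Radial graphs and the reduced ensembles -/

/-- The infinite multigraphs with vertex set `ℕ` in which `n` and `n + 1` are joined by
`G n ≥ 1` edges, and there are no other edges. -/
abbrev RadialGraph : Type := ℕ → ℕ+

instance : MeasurableSpace ℕ+ := ⊤

/-- Identify, for every `k`, all vertices of `S_k` and delete the edges in `S_k`; all edges between
`S_k` and `S_(k + 1)` are kept. -/
noncomputable def collapse (T : InfinitePlanarTree) : RadialGraph := fun k =>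
  ⟨(T.1.slice k).ncard, by
    rw [T.1.ncard_slice]
    exact Nat.lt_of_lt_of_le (T.1.length_pos T.2 (k + 1)) (Nat.le_add_left _ _)⟩

/-- The same, except that only those edges between `S_k` and `S_(k + 1)` are kept that belong to
the tree. -/
noncomputable def collapse' (T : InfinitePlanarTree) : RadialGraph := fun k =>
  ⟨(T.1.treeSlice k).ncard, by
    rw [T.1.ncard_treeSlice]
    exact T.1.length_pos T.2 (k + 1)⟩

/-- The law on radial graphs of `collapse`, for `μ` the law of a tree that is almost surely
infinite. -/
noncomputable def chiR (μ : Measure PlanarTree) : Measure RadialGraph :=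
  (μ.comap (Subtype.val : InfinitePlanarTree → PlanarTree)).map collapse

/-- The law on radial graphs of `collapse'`, for `μ` the law of a tree that is almost surely
infinite. -/
noncomputable def chiR' (μ : Measure PlanarTree) : Measure RadialGraph :=
  (μ.comap (Subtype.val : InfinitePlanarTree → PlanarTree)).map collapse'

/-! ### Random walk and spectral dimension -/

namespace RadialGraph

/-- The number of edges between the vertices `m` and `n`. -/
def edges (G : RadialGraph) (m n : ℕ) : ℕ :=
  if n = m + 1 then (G m : ℕ) else if m = n + 1 then (G n : ℕ) else 0

/-- The degree of the vertex `n`. -/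
def degree (G : RadialGraph) (n : ℕ) : ℕ := ∑ m ∈ Finset.range (n + 2), G.edges n m

/-- The probability that simple random walk started at the root `0` is at the vertex `n` at
time `t`. -/
noncomputable def walkProb (G : RadialGraph) : ℕ → ℕ → ℝ
  | 0, n => if n = 0 then 1 else 0
  | t + 1, n => ∑ m ∈ Finset.range (n + 2), walkProb G t m * ((G.edges m n : ℝ) / G.degree m)

/-- The return probability `p_G(t)`. -/
noncomputable def returnProb (G : RadialGraph) (t : ℕ) : ℝ := G.walkProb t 0

/-- The generating function `Q_G(x) = 1 + ∑_(t ≥ 1) (1 - x) ^ (t / 2) p_G(t)`. -/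
noncomputable def Q (G : RadialGraph) (x : ℝ) : ℝ :=
  1 + ∑' t : ℕ, (1 - x) ^ (((t + 1 : ℕ) : ℝ) / 2) * G.returnProb (t + 1)

end RadialGraph

/-- `d = 2 - 2 α`, where `α` is the limit of `log (q x) / |log x|` as `x → 0`, which is part of the
claim to exist. -/
def HasSpectralDimension (q : ℝ → ℝ) (d : ℝ) : Prop :=
  ∃ α : ℝ, Tendsto (fun x : ℝ => Real.log (q x) / |Real.log x|) (𝓝[>] 0) (𝓝 α) ∧ d = 2 - 2 * α

/-! The limiting tree is the critical geometric Galton-Watson tree conditioned to survive, and the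
walk on its collapsed graphs is controlled by the effective resistance up to distance about `1 / x`.

Local limit. All trees with `N` edges have the same weight (`weight_eq`), so the conditioned measure
is uniform and cylinder probabilities are quotients of numbers of forests. These are ballot numbers
(`numForests_add_choose`), whose quotients converge (`tendsto_toReal_numForests_ratio`). The limits
are the cylinder probabilities of the Markov chain of generations whose steps are Galton-Watson
steps biased by the size of the next generation (`survivingLaw_prefix`). Cylinders are clopen and
form a π-system that generates both the topology and the Borel sets. Hence convergence on them gives
weak convergence and identifies the limit.

Moments. Size-biasing is the Doob transform by the generation size `s`, so `(1 - q ^ s) / s` is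
carried by one step to the same expression with `q` replaced by `1 / (2 - q)`. Starting from `q =
0`, which gives `1 / s`, the iterates are `n / (n + 1)`. With Bernoulli's inequality this gives
`E[|S_1| / |S_(n+1)|] ≤ E|S_1| / (n + 1)` (`lintegral_length_ratio_le`). Both ensembles satisfy `L_0
= |S_1|` and `L_n ≥ |S_(n+1)|`, so `E[L_0 / L_n]` is `O(1 / n)` in both (`MomentBounds`).

Walk. `Q` is the Green function at the root of the walk killed at rate `1 - √(1 - x)`, which is at
least `x / 2`. Divided by the degree it becomes a decreasing potential, driven by a flow between `0`
and `1` through resistances `1 / L_n`. Thus `Q` is at most a constant times `L_0 * (1 + ∑ 1 / L_n)`,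
the sum running over `n` up to order `1 / x` (`Q_le_sum`). In expectation this is `O(1 + |log x|)`.
Since `Q ≥ 1`, the exponent `α` is `0` and the annealed dimension is `2`. Along `x = exp (-(k + 1))`
a summability argument bounds `Q` almost surely by a multiple of `(k + 1) ^ 3`. This forces `α = 0`
whenever the limit exists. -/

instance : MeasurableSpace (List ℕ) := ⊤

instance : DiscreteMeasurableSpace (List ℕ) := ⟨fun _ => trivial⟩

/-! ### Topology and Borel structure of the space of trees. -/

namespace PlanarTree

/-- The trees which agree with `T` on the offspring of the first `k` generations. -/
def cylinder (k : ℕ) (T : PlanarTree) : Set PlanarTree :=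
  {T' | ∀ i < k, T.offspring i = T'.offspring i}

theorem mem_cylinder_self (k : ℕ) (T : PlanarTree) : T ∈ cylinder k T := fun _ _ => rfl

theorem cylinder_eq_of_mem {k : ℕ} {T T' : PlanarTree} (h : T' ∈ cylinder k T) :
    cylinder k T' = cylinder k T := by
  ext S
  exact ⟨fun hS i hi => (h i hi).trans (hS i hi), fun hS i hi => (h i hi).symm.trans (hS i hi)⟩

theorem cylinder_anti {k l : ℕ} (h : k ≤ l) (T : PlanarTree) : cylinder l T ⊆ cylinder k T :=
  fun _ hS i hi => hS i (hi.trans_le h)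

/-- Truncated subtraction is harmless: the balls of radius `0` and `1` carry no information, and
both give the whole space. -/
theorem setOf_sameBall (R : ℕ) (T : PlanarTree) : {T' | SameBall R T T'} = cylinder (R - 1) T := by
  ext S
  exact ⟨fun h i hi => h i (by omega), fun h i hi => h i (by omega)⟩

/-- All cylinder sets. -/
def cylinders : Set (Set PlanarTree) := {U | ∃ k T, U = cylinder k T}

theorem generateFrom_cylinders :
    instTopologicalSpace = TopologicalSpace.generateFrom cylinders := by
  change TopologicalSpace.generateFrom {U | ∃ R T, U = {T' | SameBall R T T'}} = _
  congr 1
  ext U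
  constructor
  · rintro ⟨R, T, rfl⟩
    exact ⟨R - 1, T, setOf_sameBall R T⟩
  · rintro ⟨k, T, rfl⟩
    exact ⟨k + 1, T, (setOf_sameBall (k + 1) T).symm⟩

/-- A cylinder is determined by finitely many lists of natural numbers. -/
theorem countable_cylinders : cylinders.Countable := by
  have : cylinders ⊆ Set.range (fun p : (k : ℕ) × (Fin k → List ℕ) =>
      {T' : PlanarTree | ∀ i : Fin p.1, p.2 i = T'.offspring i}) := by
    rintro _ ⟨k, T, rfl⟩
    refine ⟨⟨k, fun i => T.offspring i⟩, ?_⟩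
    ext S
    exact ⟨fun h i hi => h ⟨i, hi⟩, fun h i => h i i.2⟩
  exact (Set.countable_range _).mono this

instance : SecondCountableTopology PlanarTree :=
  ⟨⟨cylinders, countable_cylinders, generateFrom_cylinders⟩⟩

theorem isOpen_cylinder (k : ℕ) (T : PlanarTree) : IsOpen (cylinder k T) := by
  rw [generateFrom_cylinders]
  exact TopologicalSpace.isOpen_generateFrom_of_mem ⟨k, T, rfl⟩

theorem isOpen_iff {U : Set PlanarTree} : IsOpen U ↔ ∀ T ∈ U, ∃ k, cylinder k T ⊆ U := by
  constructor
  · intro hU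
    rw [generateFrom_cylinders] at hU
    induction hU with
    | basic u hu =>
      obtain ⟨k, T, rfl⟩ := hu
      exact fun S hS => ⟨k, (cylinder_eq_of_mem hS).subset⟩
    | univ => exact fun _ _ => ⟨0, Set.subset_univ _⟩
    | inter s t _ _ hs ht =>
      intro T hT
      obtain ⟨k, hk⟩ := hs T hT.1
      obtain ⟨l, hl⟩ := ht T hT.2
      exact ⟨max k l, Set.subset_inter ((cylinder_anti (le_max_left k l) T).trans hk)
        ((cylinder_anti (le_max_right k l) T).trans hl)⟩
    | sUnion S _ ih =>
      rintro T ⟨s, hs, hT⟩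
      obtain ⟨k, hk⟩ := ih s hs T hT
      exact ⟨k, hk.trans (Set.subset_sUnion_of_mem hs)⟩
  · intro h
    rw [isOpen_iff_forall_mem_open]
    intro T hT
    obtain ⟨k, hk⟩ := h T hT
    exact ⟨_, hk, isOpen_cylinder k T, mem_cylinder_self k T⟩

theorem isOpen_setOf_offspring (k : ℕ) (p : List ℕ → Prop) :
    IsOpen {T : PlanarTree | p (T.offspring k)} := by
  rw [isOpen_iff]
  intro T hT
  refine ⟨k + 1, fun S hS => ?_⟩
  have := hS k (Nat.lt_succ_self k)
  change p (S.offspring k)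
  rw [← this]
  exact hT

theorem isClopen_cylinder (k : ℕ) (T : PlanarTree) : IsClopen (cylinder k T) := by
  refine ⟨⟨?_⟩, isOpen_cylinder k T⟩
  rw [isOpen_iff]
  intro S hS
  refine ⟨k, fun S' hS' h => hS ?_⟩
  rw [← cylinder_eq_of_mem h, cylinder_eq_of_mem hS']
  exact mem_cylinder_self k S

theorem measurable_offspring (k : ℕ) : Measurable fun T : PlanarTree => T.offspring k :=
  fun s _ => (isOpen_setOf_offspring k (· ∈ s)).measurableSet

theorem measurableSet_cylinder (k : ℕ) (T : PlanarTree) : MeasurableSet (cylinder k T) :=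
  (isOpen_cylinder k T).measurableSet

theorem measurableSpace_eq_generateFrom :
    instMeasurableSpace = MeasurableSpace.generateFrom cylinders :=
  borel_eq_generateFrom_of_subbasis generateFrom_cylinders

theorem isPiSystem_cylinders : IsPiSystem cylinders := by
  rintro _ ⟨k, S, rfl⟩ _ ⟨l, T, rfl⟩ ⟨U, hS, hT⟩
  rw [← cylinder_eq_of_mem hS, ← cylinder_eq_of_mem hT]
  rcases le_total k l with h | h
  · exact ⟨l, U, Set.inter_eq_right.2 (cylinder_anti h U)⟩
  · exact ⟨k, U, Set.inter_eq_left.2 (cylinder_anti h U)⟩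

/-- This lets a law be built on sequences of lists and then pulled back to trees. The range is
measurable because it is cut out by countably many conditions on the lengths of the lists. -/
theorem measurableEmbedding_offspring : MeasurableEmbedding offspring := by
  rw [MeasurableEmbedding.iff_comap_eq]
  have hm : Measurable offspring := measurable_pi_lambda _ measurable_offspring
  refine ⟨fun S T h => PlanarTree.ext h, le_antisymm hm.comap_le ?_, ?_⟩
  · change instMeasurableSpace ≤ _
    rw [measurableSpace_eq_generateFrom]
    refine MeasurableSpace.generateFrom_le ?_
    rintro _ ⟨k, T, rfl⟩
    refine ⟨{f | ∀ i < k, T.offspring i = f i}, ?_, rfl⟩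
    simp only [Set.ofPred_forall]
    refine MeasurableSet.iInter fun i => MeasurableSet.iInter fun _ => ?_
    have hi : Measurable fun f : ℕ → List ℕ => f i := measurable_pi_apply i
    exact hi (MeasurableSet.of_discrete (s := {l | T.offspring i = l}))
  · have : Set.range offspring =
        {f | (f 0).length = 1} ∩ ⋂ k, {f | (f (k + 1)).length = (f k).sum} := by
      ext f
      simp only [Set.mem_range, Set.mem_inter_iff, Set.mem_iInter, Set.mem_ofPred_eq]
      constructor
      · rintro ⟨T, rfl⟩
        exact ⟨T.length_zero, T.length_succ⟩
      · rintro ⟨h0, h1⟩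
        exact ⟨⟨f, h0, h1⟩, rfl⟩
    rw [this]
    refine MeasurableSet.inter ?_ (MeasurableSet.iInter fun k => ?_)
    · have h0 : Measurable fun f : ℕ → List ℕ => f 0 := measurable_pi_apply 0
      exact h0 (MeasurableSet.of_discrete (s := {l : List ℕ | l.length = 1}))
    · have h1 : Measurable fun f : ℕ → List ℕ => (f (k + 1)).length :=
        Measurable.comp (g := List.length) (measurable_from_top) (measurable_pi_apply (k + 1))
      have h2 : Measurable fun f : ℕ → List ℕ => (f k).sum :=
        Measurable.comp (g := List.sum) (measurable_from_top) (measurable_pi_apply k)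
      exact measurableSet_eq_fun h1 h2

end PlanarTree

/-! ### Counting forests by their size -/

/-- A sum over the lists of length `s + 1`, according to the first entry. -/
theorem tsum_length_succ (s : ℕ) (F : List ℕ → ℝ≥0∞) :
    ∑' l : {l : List ℕ // l.length = s + 1}, F l
      = ∑' j : ℕ, ∑' l : {l : List ℕ // l.length = s}, F (j :: l) := by
  rw [← ENNReal.tsum_prod]
  let e : ℕ × {l : List ℕ // l.length = s} ≃ {l : List ℕ // l.length = s + 1} :=
    { toFun := fun p => ⟨p.1 :: p.2, by simp [p.2.2]⟩
      invFun := fun l => ⟨l.1.headD 0, ⟨l.1.tail, by simp [l.2]⟩⟩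
      left_inv := fun p => by simp
      right_inv := by
        rintro ⟨l, hl⟩
        cases l with
        | nil => simp at hl
        | cons a l => simp }
  exact (e.tsum_eq fun l => F l).symm

theorem tsum_length_zero (F : List ℕ → ℝ≥0∞) :
    ∑' l : {l : List ℕ // l.length = 0}, F l = F [] := by
  rw [tsum_eq_single (⟨[], rfl⟩ : {l : List ℕ // l.length = 0})]
  rintro ⟨l, hl⟩ h
  exact absurd (Subtype.ext (List.eq_nil_of_length_eq_zero hl)) h

/-- The tail sums of a function on `ℕ`. -/
noncomputable def tailSum (φ : ℕ → ℝ≥0∞) (v : ℕ) : ℝ≥0∞ := ∑' j, φ (v + j)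

theorem tailSum_eq (φ : ℕ → ℝ≥0∞) (v : ℕ) : tailSum φ v = φ v + tailSum φ (v + 1) := by
  rw [tailSum, tsum_eq_zero_add' ENNReal.summable]
  simp only [add_zero, tailSum]
  congr 2
  ext j
  congr 1
  ring

theorem tailSum_shift (φ : ℕ → ℝ≥0∞) (v : ℕ) :
    tailSum (fun n => φ (n + 1)) v = tailSum φ (v + 1) := by
  simp only [tailSum]
  congr 1
  ext j
  congr 1
  ring

theorem tailSum_iterate_add (s : ℕ) (φ ψ : ℕ → ℝ≥0∞) :
    tailSum^[s] (φ + ψ) = tailSum^[s] φ + tailSum^[s] ψ := by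
  induction s generalizing φ ψ with
  | zero => rfl
  | succ s ih =>
    simp only [Function.iterate_succ_apply]
    rw [← ih]
    congr 1
    ext n
    simp [tailSum, ENNReal.tsum_add]

theorem tailSum_iterate_zero (s : ℕ) : tailSum^[s] 0 = 0 := by
  induction s with
  | zero => rfl
  | succ s ih =>
    rw [Function.iterate_succ_apply']
    rw [ih]
    ext n
    simp [tailSum]

/-- Summing over one entry of the list replaces `φ` by its tail sums. -/
theorem tsum_length_sum (s : ℕ) (φ : ℕ → ℝ≥0∞) (v : ℕ) :
    ∑' l : {l : List ℕ // l.length = s}, φ (v + l.1.sum) = tailSum^[s] φ v := by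
  induction s generalizing v with
  | zero => rw [tsum_length_zero fun l => φ (v + l.sum)]; simp
  | succ s ih =>
    rw [tsum_length_succ s fun l => φ (v + l.sum), Function.iterate_succ_apply', tailSum]
    congr 1
    ext j
    rw [← ih]
    simp [add_assoc]

/-- Planar forests with `s` trees, described by the offspring of the successive generations. -/
def IsForest (s : ℕ) (f : ℕ → List ℕ) : Prop :=
  (f 0).length = s ∧ ∀ k, (f (k + 1)).length = (f k).sum

/-- The number of vertices. -/
noncomputable def forestSize (f : ℕ → List ℕ) : ℝ≥0∞ := ∑' k, ((f k).length : ℝ≥0∞)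

/-- The forests of `s` trees with `M` vertices. -/
def forests (s M : ℕ) : Set (ℕ → List ℕ) := {f | IsForest s f ∧ forestSize f = M}

/-- The number of forests of `s` trees with `M` vertices. -/
noncomputable def numForests (s M : ℕ) : ℝ≥0∞ := (forests s M).encard

/-- Put a generation below the roots of a forest. -/
def consGeneration (l : List ℕ) (f : ℕ → List ℕ) : ℕ → List ℕ
  | 0 => l
  | k + 1 => f k

theorem consGeneration_injective (l : List ℕ) : Function.Injective (consGeneration l) :=
  fun _ _ h => funext fun k => congrFun h (k + 1)

theorem consGeneration_eta (f : ℕ → List ℕ) : consGeneration (f 0) (fun k => f (k + 1)) = f := by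
  ext1 k
  cases k <;> rfl

theorem isForest_consGeneration {s : ℕ} {l : List ℕ} {f : ℕ → List ℕ} :
    IsForest s (consGeneration l f) ↔ l.length = s ∧ IsForest l.sum f := by
  constructor
  · rintro ⟨h0, h1⟩
    exact ⟨h0, h1 0, fun k => h1 (k + 1)⟩
  · rintro ⟨h0, h1, h2⟩
    refine ⟨h0, fun k => ?_⟩
    cases k with
    | zero => exact h1
    | succ k => exact h2 k

theorem forestSize_consGeneration (l : List ℕ) (f : ℕ → List ℕ) :
    forestSize (consGeneration l f) = l.length + forestSize f := by
  rw [forestSize, tsum_eq_zero_add' ENNReal.summable]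
  rfl

theorem consGeneration_mem_forests {s M : ℕ} {l : List ℕ} {f : ℕ → List ℕ} :
    consGeneration l f ∈ forests s (M + s) ↔ l.length = s ∧ f ∈ forests l.sum M := by
  simp only [forests, Set.mem_ofPred_eq, isForest_consGeneration, forestSize_consGeneration]
  rw [and_assoc]
  refine and_congr_right fun h => and_congr_right fun _ => ?_
  rw [h]
  push_cast
  rw [add_comm (M : ℝ≥0∞), ENNReal.add_right_inj (by simp)]

/-- The number of forests with given first generations. -/
theorem encard_forests_prefix (k : ℕ) {s : ℕ} {t : ℕ → List ℕ} (ht : IsForest s t) (M : ℕ) :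
    ({f ∈ forests s (M + ∑ i ∈ Finset.range k, (t i).length) | ∀ i < k, t i = f i}.encard
      : ℝ≥0∞) = numForests (t k).length M := by
  induction k generalizing s t with
  | zero => simp [numForests, ht.1]
  | succ k ih =>
    rw [← consGeneration_eta t] at ht
    obtain ⟨h0, h1⟩ := isForest_consGeneration.1 ht
    rw [← ih h1]
    have hM : M + ∑ i ∈ Finset.range (k + 1), (t i).length
        = (M + ∑ i ∈ Finset.range k, (t (i + 1)).length) + s := by
      rw [Finset.sum_range_succ', h0]
      ring
    rw [hM, ← (consGeneration_injective (t 0)).encard_image {f ∈ forests (t 0).sum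
      (M + ∑ i ∈ Finset.range k, (t (i + 1)).length) | ∀ i < k, t (i + 1) = f i}]
    congr 2
    ext f
    constructor
    · rintro ⟨h2, h3⟩
      refine ⟨fun k => f (k + 1), ⟨?_, fun i hi => h3 (i + 1) (by omega)⟩, ?_⟩
      · rw [← consGeneration_eta f, consGeneration_mem_forests, ← h3 0 (by omega)] at h2
        exact h2.2
      · rw [h3 0 (by omega)]
        exact consGeneration_eta f
    · rintro ⟨g, ⟨h2, h3⟩, rfl⟩
      refine ⟨consGeneration_mem_forests.2 ⟨h0, h2⟩, fun i hi => ?_⟩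
      cases i with
      | zero => rfl
      | succ i => exact h3 i (by omega)

/-! ### Ballot numbers. -/

theorem numForests_eq_tsum (s M : ℕ) :
    numForests s (M + s) = ∑' l : {l : List ℕ // l.length = s}, numForests l.1.sum M := by
  rw [numForests, ← ENNReal.tsum_set_one]
  let e : (l : {l : List ℕ // l.length = s}) × forests l.1.sum M ≃ forests s (M + s) :=
    { toFun := fun p => ⟨consGeneration p.1 p.2, consGeneration_mem_forests.2 ⟨p.1.2, p.2.2⟩⟩
      invFun := fun f =>
        have h := (consGeneration_mem_forests (l := f.1 0) (f := fun k => f.1 (k + 1)) (s := s)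
          (M := M)).1 (by rw [consGeneration_eta]; exact f.2)
        ⟨⟨f.1 0, h.1⟩, ⟨fun k => f.1 (k + 1), h.2⟩⟩
      left_inv := fun p => rfl
      right_inv := fun f => Subtype.ext (consGeneration_eta f.1) }
  rw [← e.tsum_eq, ENNReal.tsum_sigma']
  simp only [ENNReal.tsum_set_one, numForests]

theorem numForests_eq_tailSum (s M : ℕ) :
    numForests s (M + s) = tailSum^[s] (fun v => numForests v M) 0 := by
  rw [numForests_eq_tsum, ← tsum_length_sum s (fun v => numForests v M)]
  simp

theorem numForests_eq_zero {s M : ℕ} (h : M < s) : numForests s M = 0 := by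
  have : forests s M = ∅ := by
    ext f
    simp only [forests, Set.mem_ofPred_eq, Set.mem_empty_iff_false, iff_false, not_and]
    intro hf hM
    have h1 : ((f 0).length : ℝ≥0∞) ≤ M := hM ▸ ENNReal.le_tsum 0
    rw [hf.1] at h1
    have : s ≤ M := by exact_mod_cast h1
    omega
  simp [numForests, this]

theorem forests_zero (M : ℕ) : forests 0 M = if M = 0 then {fun _ => []} else ∅ := by
  have h : ∀ f, IsForest 0 f → f = fun _ => [] := by
    intro f hf
    ext1 k
    induction k with
    | zero => exact List.eq_nil_of_length_eq_zero hf.1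
    | succ k ih => exact List.eq_nil_of_length_eq_zero (by rw [hf.2, ih]; rfl)
  split_ifs with hM
  · ext f
    constructor
    · rintro ⟨h1, _⟩
      exact h f h1
    · rintro rfl
      exact ⟨⟨rfl, fun _ => rfl⟩, by simp [forestSize, hM]⟩
  · ext f
    simp only [Set.mem_empty_iff_false, iff_false]
    rintro ⟨h1, h2⟩
    rw [h f h1] at h2
    simp [forestSize] at h2
    exact hM (by exact_mod_cast h2.symm)

theorem numForests_zero_zero : numForests 0 0 = 1 := by simp [numForests, forests_zero]

theorem numForests_zero_succ (M : ℕ) : numForests 0 (M + 1) = 0 := by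
  simp [numForests, forests_zero]

/-- The recurrence reflects the removal of a single root: it is a leaf, or it has a first child.
Here it is derived from the decomposition by generations. One of the `s + 1` tail sums of
`numForests · D` is split into its first term and the rest. The first term leads to forests of `s`
trees. In the rest, the hypothesis turns the shifted counts into a further tail sum, which leads to
`s + 2` trees. -/
theorem numForests_recurrence_aux {M : ℕ}
    (h : ∀ m < M, ∀ v, numForests (v + 1) (m + 1) = tailSum (fun v => numForests v m) v) (s : ℕ) :
    numForests (s + 1) (M + 1) = numForests s M + numForests (s + 2) (M + 1) := by
  rcases lt_or_ge M s with hs | hs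
  · simp [numForests_eq_zero, hs, show M + 1 < s + 1 by omega, show M + 1 < s + 2 by omega]
  obtain ⟨D, rfl⟩ := Nat.exists_eq_add_of_le' hs
  have h1 : tailSum (fun v => numForests v D)
      = (fun v => numForests v D) + fun v => tailSum (fun v => numForests v D) (v + 1) := by
    ext v
    exact tailSum_eq _ _
  rw [add_assoc, numForests_eq_tailSum, numForests_eq_tailSum s D, Function.iterate_succ_apply, h1,
    tailSum_iterate_add, Pi.add_apply]
  congr 1
  have h2 : (fun v => tailSum (fun v => numForests v D) (v + 1))
      = tailSum (fun v => numForests (v + 1) D) := by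
    ext v
    exact (tailSum_shift _ _).symm
  rw [h2, ← Function.iterate_succ_apply]
  -- `D` is the number of vertices below the roots of `s + 1` trees with `M + 1` vertices. If it is
  -- zero, neither the rest nor a forest of `s + 2` trees contributes.
  cases D with
  | zero =>
    rw [numForests_eq_zero (by omega)]
    have : (fun v => numForests (v + 1) 0) = 0 := by
      ext v
      exact numForests_eq_zero (by omega)
    rw [this, tailSum_iterate_zero]
    rfl
  | succ d =>
    have : (fun v => numForests (v + 1) (d + 1)) = tailSum (fun v => numForests v d) := by
      ext v
      exact h d (by omega) v
    rw [this, ← Function.iterate_succ_apply, show d + 1 + (s + 1) = d + (s + 2) by ring,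
      numForests_eq_tailSum]

/-- The recurrence telescopes downwards from large `v`, where both sides vanish because a forest has
at least as many vertices as trees. -/
theorem numForests_eq_tailSum_of_recurrence {M : ℕ}
    (h : ∀ s, numForests (s + 1) (M + 1) = numForests s M + numForests (s + 2) (M + 1)) (v : ℕ) :
    numForests (v + 1) (M + 1) = tailSum (fun v => numForests v M) v := by
  by_cases hv : M < v
  · rw [numForests_eq_zero (by omega), tailSum]
    symm
    rw [ENNReal.tsum_eq_zero]
    exact fun j => numForests_eq_zero (by omega)
  · rw [h, tailSum_eq, numForests_eq_tailSum_of_recurrence h (v + 1)]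
termination_by M + 1 - v

theorem numForests_recurrence (M s : ℕ) :
    numForests (s + 1) (M + 1) = numForests s M + numForests (s + 2) (M + 1) := by
  induction M using Nat.strong_induction_on generalizing s with
  | _ M ih =>
    exact numForests_recurrence_aux (fun m hm => numForests_eq_tailSum_of_recurrence (ih m hm)) s

theorem numForests_self (s : ℕ) : numForests s s = 1 := by
  induction s with
  | zero => exact numForests_zero_zero
  | succ s ih => rw [numForests_recurrence, ih, numForests_eq_zero (by omega), add_zero]

/-- The ballot numbers. -/
theorem numForests_add_choose (M d : ℕ) (hd : d ≤ M + 1) :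
    numForests (M + 1 - d) (M + 1) + ((M + d).choose (M + 1) : ℕ) = ((M + d).choose M : ℕ) := by
  induction M generalizing d with
  | zero =>
    obtain rfl | rfl : d = 0 ∨ d = 1 := by omega
    · simp [numForests_self]
    · simp [numForests_zero_succ]
  | succ M ih =>
    induction d with
    | zero => simp [numForests_self]
    | succ d ihd =>
      have h2 := ihd (by omega)
      rcases Nat.lt_or_ge M d with h | h
      · obtain rfl : d = M + 1 := by omega
        rw [show M + 1 + 1 - (M + 1 + 1) = 0 by omega, numForests_zero_succ, zero_add]
        congr 1
        exact Nat.choose_symm_of_eq_add (by omega)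
      · have h1 := ih (d + 1) (by omega)
        have e1 : M + 1 + 1 - (d + 1) = (M - d) + 1 := by omega
        have e2 : M + 1 + 1 - d = (M - d) + 2 := by omega
        have e3 : M + 1 - (d + 1) = M - d := by omega
        rw [e2] at h2
        rw [e3] at h1
        rw [e1, numForests_recurrence]
        have e4 : M + 1 + (d + 1) = (M + 1 + d) + 1 := by ring
        have e5 : M + (d + 1) = M + 1 + d := by ring
        rw [e5] at h1
        rw [e4, Nat.choose_succ_succ (M + 1 + d) (M + 1), Nat.choose_succ_succ (M + 1 + d) M]
        push_cast
        rw [← h1, ← h2]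
        ring

theorem numForests_ne_top (s M : ℕ) : numForests s M ≠ ∞ := by
  rcases lt_or_ge M s with h | h
  · simp [numForests_eq_zero h]
  cases M with
  | zero =>
    obtain rfl : s = 0 := by omega
    simp [numForests_zero_zero]
  | succ M =>
    have := numForests_add_choose M (M + 1 - s) (by omega)
    rw [show M + 1 - (M + 1 - s) = s by omega] at this
    refine ne_top_of_le_ne_top (ENNReal.natCast_ne_top _) (this ▸ le_self_add)

/-- Planar trees are counted by the Catalan numbers. -/
theorem numForests_one (M : ℕ) :
    ((M : ℝ≥0∞) + 1) * numForests 1 (M + 1) = (Nat.centralBinom M : ℕ) := by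
  have h := numForests_add_choose M M (by omega)
  rw [show M + 1 - M = 1 by omega, ← two_mul] at h
  have h2 : (2 * M).choose (M + 1) * (M + 1) = (2 * M).choose M * M := by
    rw [Nat.choose_succ_right_eq, show 2 * M - M = M by omega]
  have h3 : (((2 * M).choose (M + 1) : ℕ) : ℝ≥0∞) * (M + 1) = ((2 * M).choose M : ℕ) * M := by
    exact_mod_cast h2
  have h4 : ((M : ℝ≥0∞) + 1) * numForests 1 (M + 1) + ((2 * M).choose M : ℕ) * M
      = ((2 * M).choose M : ℕ) + ((2 * M).choose M : ℕ) * M := by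
    rw [← h3]
    calc _ = (numForests 1 (M + 1) + ((2 * M).choose (M + 1) : ℕ)) * (M + 1) := by ring
      _ = _ := by rw [h, mul_add, mul_one, h3, add_comm]
  rw [Nat.centralBinom]
  exact (ENNReal.add_left_inj (by finiteness)).1 h4

theorem numForests_one_pos (M : ℕ) : numForests 1 (M + 1) ≠ 0 := by
  intro h
  have := numForests_one M
  rw [h, mul_zero] at this
  have h2 := Nat.centralBinom_pos M
  have : Nat.centralBinom M = 0 := by exact_mod_cast this.symm
  omega

theorem toReal_numForests_one_ratio (M : ℕ) :
    (numForests 1 (M + 1)).toReal / (numForests 1 (M + 1 + 1)).toReal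
      = ((M : ℝ) + 2) / (2 * (2 * M + 1)) := by
  have h (M : ℕ) : ((M : ℝ) + 1) * (numForests 1 (M + 1)).toReal = (Nat.centralBinom M : ℝ) := by
    have := congrArg ENNReal.toReal (numForests_one M)
    rw [ENNReal.toReal_mul, ENNReal.toReal_add (by simp) (by simp)] at this
    simpa using this
  have h1 := h M
  have h2 := h (M + 1)
  have h3 : ((M : ℝ) + 1) * (Nat.centralBinom (M + 1) : ℝ)
      = 2 * (2 * M + 1) * (Nat.centralBinom M : ℝ) := by
    exact_mod_cast Nat.succ_mul_centralBinom_succ M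
  have hpos : 0 < (numForests 1 (M + 1 + 1)).toReal :=
    ENNReal.toReal_pos (numForests_one_pos _) (numForests_ne_top _ _)
  rw [div_eq_div_iff hpos.ne' (by positivity)]
  have hM : ((M : ℝ) + 1) ≠ 0 := by positivity
  apply mul_left_cancel₀ hM
  push_cast at h2
  calc _ = (2 * (2 * M + 1)) * ((M + 1) * (numForests 1 (M + 1)).toReal) := by ring
    _ = ((M : ℝ) + 1) * (Nat.centralBinom (M + 1) : ℝ) := by rw [h1, h3]
    _ = _ := by rw [← h2]; ring

theorem tendsto_toReal_numForests_one_ratio :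
    Tendsto (fun N => (numForests 1 N).toReal / (numForests 1 (N + 1)).toReal) atTop
      (𝓝 (1 / 4)) := by
  rw [← tendsto_add_atTop_iff_nat 1]
  simp only [toReal_numForests_one_ratio]
  have h : Tendsto (fun M : ℕ => 1 / 4 + (3 / 4) * (1 / (2 * (M : ℝ) + 1))) atTop
      (𝓝 (1 / 4 + (3 / 4) * 0)) := by
    refine tendsto_const_nhds.add (Tendsto.const_mul _ ?_)
    have := tendsto_one_div_add_atTop_nhds_zero_nat (𝕜 := ℝ)
    refine (this.comp (tendsto_id.const_mul_atTop' (r := 2) (by norm_num))).congr fun M => ?_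
    simp
  simp only [mul_zero, add_zero] at h
  refine h.congr fun M => ?_
  have : (2 * (M : ℝ) + 1) ≠ 0 := by positivity
  field_simp
  ring

/-- For one tree this follows from the growth rate `4` of the Catalan numbers. The recurrence,
solved for its last term, is then linear of second order in `s`, and removing a vertex from the
forest amounts to raising `m` by one. -/
theorem tendsto_toReal_numForests_ratio (s m : ℕ) :
    Tendsto (fun N => (numForests s N).toReal / (numForests 1 (N + m)).toReal) atTop
      (𝓝 (2 * s * (1 / 2) ^ (2 * m + s))) := by
  induction s using Nat.twoStepInduction generalizing m with
  | zero =>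
    simp only [Nat.cast_zero, mul_zero, zero_mul]
    refine tendsto_const_nhds.congr' ?_
    filter_upwards [eventually_ge_atTop 1] with N hN
    obtain ⟨N, rfl⟩ := Nat.exists_eq_add_of_le' hN
    simp [numForests_zero_succ]
  | one =>
    induction m with
    | zero =>
      refine tendsto_const_nhds.congr' ?_
      filter_upwards [eventually_ge_atTop 1] with N hN
      obtain ⟨N, rfl⟩ := Nat.exists_eq_add_of_le' hN
      rw [add_zero, div_self (ENNReal.toReal_pos (numForests_one_pos _)
        (numForests_ne_top _ _)).ne']
      norm_num
    | succ m ih =>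
      have h := ih.mul (tendsto_toReal_numForests_one_ratio.comp (tendsto_add_atTop_nat m))
      have e : 2 * ((1 : ℕ) : ℝ) * (1 / 2) ^ (2 * (m + 1) + 1)
          = 2 * ((1 : ℕ) : ℝ) * (1 / 2) ^ (2 * m + 1) * (1 / 4) := by
        rw [show 2 * (m + 1) + 1 = 2 * m + 1 + 2 by ring, pow_add]
        norm_num
        ring
      rw [e]
      refine h.congr' ?_
      filter_upwards [eventually_ge_atTop 1] with N hN
      obtain ⟨N, rfl⟩ := Nat.exists_eq_add_of_le' hN
      have : (numForests 1 (N + 1 + m)).toReal ≠ 0 := by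
        rw [show N + 1 + m = N + m + 1 by ring]
        exact (ENNReal.toReal_pos (numForests_one_pos _) (numForests_ne_top _ _)).ne'
      simp only [Function.comp_apply]
      rw [div_mul_div_cancel₀ this]
      rfl
  | more s ih0 ih1 =>
    rw [← tendsto_add_atTop_iff_nat 1]
    have h := ((tendsto_add_atTop_iff_nat 1).2 (ih1 m)).sub (ih0 (m + 1))
    have e : 2 * ((s + 2 : ℕ) : ℝ) * (1 / 2) ^ (2 * m + (s + 2))
        = 2 * ((s + 1 : ℕ) : ℝ) * (1 / 2) ^ (2 * m + (s + 1))
          - 2 * (s : ℝ) * (1 / 2) ^ (2 * (m + 1) + s) := by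
      rw [show 2 * (m + 1) + s = 2 * m + s + 2 by ring]
      simp only [← add_assoc, pow_succ]
      push_cast
      ring
    rw [e]
    refine h.congr fun N => ?_
    rw [show N + (m + 1) = N + 1 + m by ring, ← sub_div]
    congr 1
    rw [numForests_recurrence N s, ENNReal.toReal_add (numForests_ne_top _ _)
      (numForests_ne_top _ _)]
    ring

/-! ### The Galton-Watson tree conditioned to survive -/

/-- The probability that the vertices of a generation have given numbers of children. -/
noncomputable def offspringWeight (l : List ℕ) : ℝ≥0∞ := (2⁻¹ : ℝ≥0∞) ^ (l.length + l.sum)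

theorem offspringWeight_cons (j : ℕ) (l : List ℕ) :
    offspringWeight (j :: l) = 2⁻¹ ^ (j + 1) * offspringWeight l := by
  simp only [offspringWeight, List.length_cons, List.sum_cons, ← pow_add]
  congr 1
  ring

theorem tsum_offspringWeight_mul_pow (q : ℝ≥0∞) (s : ℕ) :
    ∑' l : {l : List ℕ // l.length = s}, offspringWeight l * q ^ l.1.sum
      = (∑' j : ℕ, 2⁻¹ ^ (j + 1) * q ^ j) ^ s := by
  induction s with
  | zero =>
    rw [tsum_length_zero fun l => offspringWeight l * q ^ l.sum]
    simp [offspringWeight]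
  | succ s ih =>
    rw [tsum_length_succ s fun l => offspringWeight l * q ^ l.sum, pow_succ', ← ih,
      ← ENNReal.tsum_mul_right]
    congr 1
    ext j
    rw [← ENNReal.tsum_mul_left]
    congr 1
    ext l
    rw [offspringWeight_cons, List.sum_cons, pow_add]
    ring

theorem tsum_two_inv_pow_succ : ∑' j : ℕ, (2⁻¹ : ℝ≥0∞) ^ (j + 1) = 1 := by
  simp only [pow_succ, ENNReal.tsum_mul_right, ENNReal.tsum_geometric, ENNReal.one_sub_inv_two,
    inv_inv]
  exact ENNReal.mul_inv_cancel (by simp) (by simp)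

theorem tsum_offspringWeight (s : ℕ) :
    ∑' l : {l : List ℕ // l.length = s}, offspringWeight l = 1 := by
  have := tsum_offspringWeight_mul_pow 1 s
  simpa [tsum_two_inv_pow_succ] using this

theorem tsum_two_inv_pow_succ_mul : ∑' j : ℕ, (2⁻¹ : ℝ≥0∞) ^ (j + 1) * j = 1 := by
  have h := (hasSum_coe_mul_geometric_of_norm_lt_one (r := (2⁻¹ : ℝ)) (by norm_num)).mul_left 2⁻¹
  have h2 := ENNReal.ofReal_tsum_of_nonneg (fun n => by positivity) h.summable
  rw [h.tsum_eq] at h2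
  norm_num at h2
  rw [h2]
  congr 1
  ext j
  rw [one_div, ENNReal.ofReal_inv_of_pos (by norm_num), ENNReal.ofReal_ofNat]
  ring

/-- Criticality: the generation size is harmonic, which makes the size-biased step a probability. -/
theorem tsum_offspringWeight_mul_sum (s : ℕ) :
    ∑' l : {l : List ℕ // l.length = s}, offspringWeight l * l.1.sum = s := by
  induction s with
  | zero =>
    rw [tsum_length_zero fun l => offspringWeight l * l.sum]
    simp
  | succ s ih =>
    rw [tsum_length_succ s fun l => offspringWeight l * l.sum]
    have h (j : ℕ) : ∑' l : {l : List ℕ // l.length = s},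
        offspringWeight (j :: l) * (j :: l.1).sum = 2⁻¹ ^ (j + 1) * j + 2⁻¹ ^ (j + 1) * s := by
      conv_rhs => rw [← ih, ← mul_one (2⁻¹ ^ (j + 1) * (j : ℝ≥0∞)), ← tsum_offspringWeight s,
        ← ENNReal.tsum_mul_left, ← ENNReal.tsum_mul_left, ← ENNReal.tsum_add]
      congr 1
      ext l
      rw [offspringWeight_cons, List.sum_cons]
      push_cast
      ring
    simp only [h]
    rw [ENNReal.tsum_add, tsum_two_inv_pow_succ_mul, ENNReal.tsum_mul_right,
      tsum_two_inv_pow_succ]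
    push_cast
    ring

/-- The law of a generation with `s` vertices of the Galton-Watson tree, biased by the size of the
next generation. -/
noncomputable def sizeBiasedStep (s : ℕ) (hs : s ≠ 0) : PMF (List ℕ) :=
  ⟨fun l => {l : List ℕ | l.length = s}.indicator
      (fun l => (s : ℝ≥0∞)⁻¹ * (offspringWeight l * l.sum)) l, by
    rw [ENNReal.summable.hasSum_iff, ← tsum_subtype {l : List ℕ | l.length = s}
      fun l => (s : ℝ≥0∞)⁻¹ * (offspringWeight l * l.sum), ENNReal.tsum_mul_left]
    have := tsum_offspringWeight_mul_sum s
    change (s : ℝ≥0∞)⁻¹ * ∑' l : {l : List ℕ // l.length = s}, offspringWeight l * l.1.sum = 1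
    rw [this]
    exact ENNReal.inv_mul_cancel (by exact_mod_cast hs) (by simp)⟩

theorem sizeBiasedStep_apply (s : ℕ) (hs : s ≠ 0) (l : List ℕ) :
    sizeBiasedStep s hs l = {l : List ℕ | l.length = s}.indicator
      (fun l => (s : ℝ≥0∞)⁻¹ * (offspringWeight l * l.sum)) l := rfl

/-- The law of a generation with `s` vertices of the tree conditioned to survive. -/
noncomputable def survivingStep (s : ℕ) : PMF (List ℕ) :=
  if hs : s = 0 then PMF.pure [] else sizeBiasedStep s hs

theorem mul_survivingStep (s : ℕ) (l : List ℕ) (hl : l.length = s) :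
    s * survivingStep s l = offspringWeight l * l.sum := by
  by_cases hs : s = 0
  · subst hs
    rw [List.eq_nil_of_length_eq_zero hl]
    simp
  · rw [survivingStep, dif_neg hs, sizeBiasedStep_apply, Set.indicator_of_mem (by exact hl),
      ← mul_assoc, ENNReal.mul_inv_cancel (by exact_mod_cast hs) (by simp), one_mul]

theorem survivingStep_eq_zero {s : ℕ} {l : List ℕ} (hl : l.length ≠ s) :
    survivingStep s l = 0 := by
  by_cases hs : s = 0
  · rw [survivingStep, dif_pos hs, PMF.pure_apply, if_neg]
    rintro rfl
    exact hl hs.symm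
  · rw [survivingStep, dif_neg hs, sizeBiasedStep_apply]
    exact Set.indicator_of_notMem (by exact hl) _

theorem survivingStep_toMeasure_length (s : ℕ) :
    (survivingStep s).toMeasure {l | l.length ≠ s} = 0 := by
  rw [PMF.toMeasure_apply _ (MeasurableSet.of_discrete), ENNReal.tsum_eq_zero]
  intro l
  by_cases h : l.length = s
  · exact Set.indicator_of_notMem (by simpa using h) _
  · rw [Set.indicator_of_mem (by exact h), survivingStep_eq_zero h]

open ProbabilityTheory in
/-- The transition kernels of the tree conditioned to survive. -/
noncomputable def survivingKernel (n : ℕ) :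
    Kernel ((i : Finset.Iic n) → (fun _ : ℕ => List ℕ) i) (List ℕ) :=
  Kernel.ofFunOfCountable fun h => (survivingStep (h ⟨n, by simp⟩).sum).toMeasure

open ProbabilityTheory in
instance (n : ℕ) : IsMarkovKernel (survivingKernel n) :=
  ⟨fun _ => PMF.toMeasure.isProbabilityMeasure _⟩

open ProbabilityTheory in
/-- The law of the generations of the tree conditioned to survive. -/
noncomputable def survivingLaw : Measure (ℕ → List ℕ) :=
  Kernel.trajMeasure (X := fun _ => List ℕ) (survivingStep 1).toMeasure survivingKernel

open ProbabilityTheory in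
instance : IsProbabilityMeasure survivingLaw := by
  unfold survivingLaw
  infer_instance

open ProbabilityTheory in
theorem survivingLaw_map_zero :
    survivingLaw.map (fun f => f 0) = (survivingStep 1).toMeasure := by
  have h : survivingLaw.map (Preorder.frestrictLe (π := fun _ => List ℕ) 0)
      = (survivingStep 1).toMeasure.map (MeasurableEquiv.piUnique
        (fun _ : Finset.Iic 0 => List ℕ)).symm := by
    unfold survivingLaw Kernel.trajMeasure
    rw [Measure.map_comp _ _ (by fun_prop), Kernel.traj_map_frestrictLe, Kernel.partialTraj_self,
      Measure.id_comp]
  have h2 := congrArg (Measure.map (MeasurableEquiv.piUnique (fun _ : Finset.Iic 0 => List ℕ))) h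
  rw [MeasurableEquiv.map_map_symm, Measure.map_map (by fun_prop) (by fun_prop)] at h2
  exact h2

open ProbabilityTheory in
theorem survivingLaw_map_succ (k : ℕ) :
    (survivingLaw.map (Preorder.frestrictLe k)) ⊗ₘ survivingKernel k
      = survivingLaw.map (fun f => (Preorder.frestrictLe k f, f (k + 1))) :=
  Kernel.map_frestrictLe_trajMeasure_compProd_eq_map_trajMeasure

theorem survivingLaw_length_zero : ∀ᵐ f ∂survivingLaw, (f 0).length = 1 := by
  have := survivingStep_toMeasure_length 1
  rw [← survivingLaw_map_zero, Measure.map_apply (measurable_pi_apply 0)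
    MeasurableSet.of_discrete] at this
  exact this

theorem survivingLaw_length_succ (k : ℕ) :
    ∀ᵐ f ∂survivingLaw, (f (k + 1)).length = (f k).sum := by
  have hs : MeasurableSet {p : ((i : Finset.Iic k) → List ℕ) × List ℕ |
      p.2.length ≠ (p.1 ⟨k, by simp⟩).sum} := MeasurableSet.of_discrete
  have h : (survivingLaw.map (fun f => (Preorder.frestrictLe k f, f (k + 1))))
      {p : ((i : Finset.Iic k) → List ℕ) × List ℕ | p.2.length ≠ (p.1 ⟨k, by simp⟩).sum} = 0 := by
    rw [← survivingLaw_map_succ, Measure.compProd_apply hs]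
    simp only [lintegral_eq_zero_iff' (Measurable.of_discrete.aemeasurable)]
    refine Eventually.of_forall fun h => ?_
    exact survivingStep_toMeasure_length _
  rw [Measure.map_apply (by fun_prop) hs] at h
  exact h

/-- The size biases telescope: each step multiplies by the size of the next generation and divides
by that of the present one. -/
theorem survivingLaw_prefix (k : ℕ) {t : ℕ → List ℕ} (ht : IsForest 1 t) :
    survivingLaw {f | ∀ i < k, t i = f i}
      = (t k).length * ∏ i ∈ Finset.range k, offspringWeight (t i) := by
  induction k with
  | zero => simp [ht.1]
  | succ k ih =>
    -- The first generation comes from the initial law of the chain, the later ones from its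
    -- kernels.
    cases k with
    | zero =>
      have h := PMF.toMeasure_apply_singleton (survivingStep 1) (t 0) (MeasurableSet.of_discrete)
      rw [← survivingLaw_map_zero, Measure.map_apply (measurable_pi_apply 0)
        MeasurableSet.of_discrete] at h
      have h1 := mul_survivingStep 1 (t 0) ht.1
      simp only [Nat.cast_one, one_mul] at h1
      rw [ht.2 0]
      simp only [zero_add, Finset.range_one, Finset.prod_singleton]
      rw [mul_comm, ← h1, ← h]
      congr 1
      ext f
      simp [eq_comm]
    | succ k =>
      let P : Set ((i : Finset.Iic k) → (fun _ : ℕ => List ℕ) i) := {Preorder.frestrictLe k t}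
      let Q : Set (List ℕ) := {t (k + 1)}
      have hP : MeasurableSet P := MeasurableSet.of_discrete
      have hQ : MeasurableSet Q := MeasurableSet.of_discrete
      have e1 : (Preorder.frestrictLe k) ⁻¹' P = {f : ℕ → List ℕ | ∀ i < k + 1, t i = f i} := by
        ext f
        simp only [Set.mem_ofPred_eq, Set.mem_preimage, P, Set.mem_singleton_iff, funext_iff]
        constructor
        · exact fun h i hi => (h ⟨i, Finset.mem_Iic.2 (by omega)⟩).symm
        · exact fun h i => (h i (by have := Finset.mem_Iic.1 i.2; omega)).symm
      have e : (fun f : ℕ → List ℕ => (Preorder.frestrictLe k f, f (k + 1))) ⁻¹' (P ×ˢ Q)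
          = {f : ℕ → List ℕ | ∀ i < k + 1 + 1, t i = f i} := by
        rw [Set.mk_preimage_prod, e1]
        ext f
        simp only [Set.mem_ofPred_eq, Set.mem_inter_iff, Set.mem_preimage, Q,
          Set.mem_singleton_iff]
        constructor
        · rintro ⟨h1, h2⟩ i hi
          rcases Nat.lt_succ_iff_lt_or_eq.1 hi with h3 | rfl
          · exact h1 i h3
          · exact h2.symm
        · exact fun h => ⟨fun i hi => h i (by omega), (h _ (by omega)).symm⟩
      have h : (survivingLaw.map (fun f => (Preorder.frestrictLe k f, f (k + 1)))) (P ×ˢ Q)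
          = survivingStep (t k).sum (t (k + 1)) * survivingLaw {f | ∀ i < k + 1, t i = f i} := by
        rw [← survivingLaw_map_succ, Measure.compProd_apply_prod hP hQ, lintegral_singleton,
          Measure.map_apply (by fun_prop) hP, e1]
        congr 1
        exact PMF.toMeasure_apply_singleton _ _ MeasurableSet.of_discrete
      rw [Measure.map_apply (by fun_prop) (hP.prod hQ), e] at h
      rw [h, ih, Finset.prod_range_succ _ (k + 1), ht.2 (k + 1), ht.2 k]
      have := mul_survivingStep (t k).sum (t (k + 1)) (ht.2 k)
      calc _ = (∏ i ∈ Finset.range (k + 1), offspringWeight (t i))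
            * ((t k).sum * survivingStep (t k).sum (t (k + 1))) := by ring
        _ = _ := by rw [this]; ring

namespace PlanarTree

/-! ### The local limit of the conditioned Galton-Watson trees -/

theorem isForest_offspring (T : PlanarTree) : IsForest 1 T.offspring :=
  ⟨T.length_zero, T.length_succ⟩

/-- The law of the Galton-Watson tree conditioned to survive. -/
noncomputable def survivingTree : Measure PlanarTree := survivingLaw.comap offspring

theorem ae_mem_range_offspring : ∀ᵐ f ∂survivingLaw, f ∈ Set.range offspring := by
  filter_upwards [survivingLaw_length_zero, ae_all_iff.2 survivingLaw_length_succ] with f h0 h1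
  exact ⟨⟨f, h0, h1⟩, rfl⟩

theorem survivingTree_preimage (S : Set (ℕ → List ℕ)) :
    survivingTree (offspring ⁻¹' S) = survivingLaw S := by
  rw [survivingTree, measurableEmbedding_offspring.comap_apply, Set.image_preimage_eq_inter_range]
  exact measure_congr (inter_ae_eq_left_of_ae_eq_univ (eventuallyEq_univ.2 ae_mem_range_offspring))

instance : IsProbabilityMeasure survivingTree :=
  ⟨by rw [← Set.preimage_univ (f := offspring), survivingTree_preimage]; simp⟩

theorem survivingTree_cylinder (k : ℕ) (T : PlanarTree) :
    survivingTree (cylinder k T)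
      = (T.offspring k).length * ∏ i ∈ Finset.range k, offspringWeight (T.offspring i) := by
  rw [← survivingLaw_prefix k T.isForest_offspring, ← survivingTree_preimage]
  rfl

theorem tsum_vertices (T : PlanarTree) (F : ℕ × ℕ → ℝ≥0∞) :
    ∑' v : T.vertices, F v = ∑' k, ∑ i ∈ Finset.range (T.offspring k).length, F (k, i) := by
  rw [tsum_subtype, ENNReal.tsum_prod']
  congr 1
  ext k
  rw [tsum_eq_sum (s := Finset.range (T.offspring k).length)]
  · refine Finset.sum_congr rfl fun i hi => Set.indicator_of_mem ?_ _
    exact Finset.mem_range.1 hi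
  · intro i hi
    exact Set.indicator_of_notMem (fun h : (k, i) ∈ T.vertices => hi (Finset.mem_range.2 h)) _

theorem encard_vertices (T : PlanarTree) : (T.vertices.encard : ℝ≥0∞) = forestSize T.offspring := by
  rw [← ENNReal.tsum_set_one, T.tsum_vertices fun _ => 1]
  simp [forestSize]

theorem mem_withEdges_iff {T : PlanarTree} {N : ℕ} :
    T ∈ withEdges N ↔ T.offspring ∈ forests 1 N := by
  change _ ↔ IsForest 1 T.offspring ∧ _
  rw [and_iff_right T.isForest_offspring, ← encard_vertices]
  change T.vertices.encard = N ↔ _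
  rw [← ENat.toENNReal_coe, ENat.toENNReal_inj]

theorem image_offspring_withEdges (N : ℕ) : offspring '' withEdges N = forests 1 N := by
  ext f
  constructor
  · rintro ⟨T, hT, rfl⟩
    exact mem_withEdges_iff.1 hT
  · intro hf
    exact ⟨⟨f, hf.1.1, hf.1.2⟩, mem_withEdges_iff.2 hf, rfl⟩

theorem encard_withEdges (N : ℕ) : ((withEdges N).encard : ℝ≥0∞) = numForests 1 N := by
  rw [numForests, ← image_offspring_withEdges, measurableEmbedding_offspring.injective.encard_image]

theorem encard_withEdges_inter_cylinder (k M : ℕ) (T : PlanarTree) :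
    ((withEdges (M + ∑ i ∈ Finset.range k, (T.offspring i).length) ∩ cylinder k T).encard
      : ℝ≥0∞) = numForests (T.offspring k).length M := by
  rw [← encard_forests_prefix k T.isForest_offspring,
    ← measurableEmbedding_offspring.injective.encard_image]
  congr 2
  ext f
  constructor
  · rintro ⟨S, ⟨h1, h2⟩, rfl⟩
    exact ⟨mem_withEdges_iff.1 h1, h2⟩
  · rintro ⟨h1, h2⟩
    exact ⟨⟨f, h1.1.1, h1.1.2⟩, ⟨mem_withEdges_iff.2 h1, h2⟩, rfl⟩

/-- The exponents add up to the number of vertices other than the root plus the number of their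
children, that is, `(N + 1) + N`. -/
theorem weight_eq {N : ℕ} {T : PlanarTree} (hT : T ∈ withEdges (N + 1)) :
    weight T = 2⁻¹ ^ (2 * N + 1) := by
  have hT' : T.vertices.encard = ((N + 1 : ℕ) : ℕ∞) := hT
  have hfin : T.vertices.Finite := Set.finite_of_encard_eq_coe hT'
  rw [weight, finprod_mem_eq_finite_toFinset_prod _ hfin]
  simp only [offspringProb]
  rw [Finset.prod_pow_eq_pow_sum]
  congr 1
  have h1 : ∑ v ∈ hfin.toFinset, (1 : ℝ≥0∞) = (N + 1 : ℕ) := by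
    simp only [Finset.sum_const, nsmul_eq_mul, mul_one]
    congr 1
    rw [hfin.encard_eq_coe_toFinset_card] at hT'
    exact_mod_cast hT'
  -- The extra `1` is the neighbour of the root, the only such vertex that is not a child of
  -- another.
  have h2 : (∑ v ∈ hfin.toFinset, (T.children v : ℝ≥0∞)) + 1 = (N + 1 : ℕ) := by
    have h3 := congrArg (fun n : ℕ∞ => (n : ℝ≥0∞)) hT'
    simp only [encard_vertices, ENat.toENNReal_coe] at h3
    rw [← h3, forestSize, tsum_eq_zero_add' ENNReal.summable, T.length_zero, add_comm]
    congr 1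
    · simp
    · have h4 := T.tsum_vertices fun v => (T.children v : ℝ≥0∞)
      have h5 : ∑' v : T.vertices, (T.children v : ℝ≥0∞)
          = ∑ v ∈ hfin.toFinset, (T.children v : ℝ≥0∞) := by
        rw [← hfin.toFinset.tsum_subtype' fun v => (T.children v : ℝ≥0∞), hfin.coe_toFinset]
      rw [← h5, h4]
      congr 1
      ext k
      rw [← length_eq_sum]
      push_cast
      rfl
  have h3 : (∑ v ∈ hfin.toFinset, T.children v) + 1 = N + 1 := by exact_mod_cast h2
  have h4 : ∑ v ∈ hfin.toFinset, 1 = N + 1 := by exact_mod_cast h1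
  rw [Finset.sum_add_distrib, h4]
  omega

theorem conditionedGW_apply (N : ℕ) {U : Set PlanarTree} (hU : MeasurableSet U) :
    conditionedGW (N + 1) U = ((withEdges (N + 1) ∩ U).encard : ℝ≥0∞) / numForests 1 (N + 1) := by
  have hw (T : withEdges (N + 1)) : weight T = 2⁻¹ ^ (2 * N + 1) := weight_eq T.2
  have h1 : ∑' T : withEdges (N + 1), weight T = 2⁻¹ ^ (2 * N + 1) * numForests 1 (N + 1) := by
    simp only [hw]
    rw [← encard_withEdges, ← ENNReal.tsum_set_one, ← ENNReal.tsum_mul_left, mul_one]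
  have h2 : ∑' T : withEdges (N + 1), U.indicator (1 : PlanarTree → ℝ≥0∞) T
      = (withEdges (N + 1) ∩ U).encard := by
    rw [tsum_subtype (withEdges (N + 1)) (U.indicator (1 : PlanarTree → ℝ≥0∞)),
      ← ENNReal.tsum_set_one, tsum_subtype _ fun _ => (1 : ℝ≥0∞), Set.indicator_indicator]
    rfl
  rw [conditionedGW, Measure.smul_apply, Measure.sum_apply _ hU, h1]
  simp only [Measure.smul_apply, hw, Measure.dirac_apply' _ hU, smul_eq_mul]
  rw [ENNReal.tsum_mul_left, h2]
  have hc : (2⁻¹ : ℝ≥0∞) ^ (2 * N + 1) ≠ 0 := by simp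
  have hc' : (2⁻¹ : ℝ≥0∞) ^ (2 * N + 1) ≠ ∞ := ENNReal.pow_ne_top (by simp)
  rw [ENNReal.mul_inv (Or.inl hc) (Or.inl hc'), div_eq_mul_inv]
  calc _ = ((2⁻¹ ^ (2 * N + 1))⁻¹ * 2⁻¹ ^ (2 * N + 1)) *
        (((withEdges (N + 1) ∩ U).encard : ℝ≥0∞) * (numForests 1 (N + 1))⁻¹) := by ring
    _ = _ := by rw [ENNReal.inv_mul_cancel hc hc', one_mul]

instance (N : ℕ) : IsProbabilityMeasure (conditionedGW (N + 1)) := by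
  constructor
  rw [conditionedGW_apply N MeasurableSet.univ, Set.inter_univ, encard_withEdges]
  exact ENNReal.div_self (numForests_one_pos N) (numForests_ne_top _ _)

theorem sum_length_add_sum (T : PlanarTree) (k : ℕ) :
    (∑ i ∈ Finset.range k, ((T.offspring i).length + (T.offspring i).sum)) + 1
      = 2 * (∑ i ∈ Finset.range k, (T.offspring i).length) + (T.offspring k).length := by
  induction k with
  | zero => simp [T.length_zero]
  | succ k ih =>
    rw [Finset.sum_range_succ, Finset.sum_range_succ, T.length_succ]
    omega

/-- A tree in the cylinder is the fixed part, with `m` edges, followed by a forest with one tree for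
each vertex of generation `k`; the forest asymptotics apply. -/
theorem tendsto_conditionedGW_cylinder (k : ℕ) (T : PlanarTree) :
    Tendsto (fun N => (conditionedGW (N + 1)).real (cylinder k T)) atTop
      (𝓝 (survivingTree.real (cylinder k T))) := by
  set m := ∑ i ∈ Finset.range k, (T.offspring i).length with hm
  have hlim : survivingTree.real (cylinder k T)
      = 2 * ((T.offspring k).length : ℝ) * (1 / 2) ^ (2 * m + (T.offspring k).length) := by
    rw [measureReal_def, survivingTree_cylinder]
    simp only [offspringWeight]
    rw [Finset.prod_pow_eq_pow_sum, hm, ← sum_length_add_sum, pow_succ]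
    simp
    ring
  rw [hlim, ← tendsto_add_atTop_iff_nat m]
  refine ((tendsto_add_atTop_iff_nat 1).2
    (tendsto_toReal_numForests_ratio (T.offspring k).length m)).congr fun N => ?_
  rw [measureReal_def, conditionedGW_apply _ (measurableSet_cylinder k T),
    show N + m + 1 = N + 1 + m by ring, encard_withEdges_inter_cylinder, ENNReal.toReal_div]

theorem isUniformInfinitePlanarTree_survivingTree : IsUniformInfinitePlanarTree survivingTree := by
  refine ⟨inferInstance, fun f => ?_⟩
  -- The index is shifted because no tree here has zero edges, so `conditionedGW 0` is not a
  -- probability measure.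
  let μ (N : ℕ) : ProbabilityMeasure PlanarTree := ⟨conditionedGW (N + 1), inferInstance⟩
  let ν : ProbabilityMeasure PlanarTree := ⟨survivingTree, inferInstance⟩
  have h : Tendsto μ atTop (𝓝 ν) := by
    refine isPiSystem_cylinders.tendsto_probabilityMeasure_of_tendsto_of_mem ?_ ?_ ?_
    · rintro _ ⟨k, T, rfl⟩
      exact measurableSet_cylinder k T
    · intro u hu T hT
      obtain ⟨k, hk⟩ := isOpen_iff.1 hu T hT
      exact ⟨_, ⟨k, T, rfl⟩, (isOpen_cylinder k T).mem_nhds (mem_cylinder_self k T), hk⟩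
    · rintro _ ⟨k, T, rfl⟩
      rw [← NNReal.tendsto_coe]
      exact tendsto_conditionedGW_cylinder k T
  rw [← tendsto_add_atTop_iff_nat 1]
  exact ProbabilityMeasure.tendsto_iff_forall_integral_tendsto.1 h f

/-- Indicators of cylinders are continuous, so weak convergence already fixes the mass of every
cylinder. -/
theorem IsUniformInfinitePlanarTree.eq_survivingTree {μ : Measure PlanarTree}
    (hμ : IsUniformInfinitePlanarTree μ) : μ = survivingTree := by
  have := hμ.1
  refine ext_of_generate_finite cylinders measurableSpace_eq_generateFrom isPiSystem_cylinders ?_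
    (by simp)
  rintro _ ⟨k, T, rfl⟩
  have h1 := hμ.2 (BoundedContinuousFunction.indicator (cylinder k T) (isClopen_cylinder k T))
  rw [← tendsto_add_atTop_iff_nat 1] at h1
  have h2 (ν : Measure PlanarTree) : ∫ S, BoundedContinuousFunction.indicator (cylinder k T)
      (isClopen_cylinder k T) S ∂ν = ν.real (cylinder k T) :=
    integral_indicator_one (measurableSet_cylinder k T)
  simp only [h2] at h1
  rw [← measureReal_eq_measureReal_iff]
  exact tendsto_nhds_unique h1 (tendsto_conditionedGW_cylinder k T)

theorem existsUnique_isUniformInfinitePlanarTree :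
    ∃! μ : Measure PlanarTree, IsUniformInfinitePlanarTree μ :=
  ⟨survivingTree, isUniformInfinitePlanarTree_survivingTree, fun _ h => h.eq_survivingTree⟩

/-- The mass of a cylinder has the size of generation `k` as a factor, so the extinct trees are
covered by countably many null cylinders. -/
theorem ae_offspring_ne_nil (k : ℕ) : ∀ᵐ T ∂survivingTree, T.offspring k ≠ [] := by
  have h : {T : PlanarTree | ¬ T.offspring k ≠ []}
      ⊆ ⋃₀ {U ∈ cylinders | survivingTree U = 0} := by
    intro T hT
    refine ⟨cylinder k T, ⟨⟨k, T, rfl⟩, ?_⟩, mem_cylinder_self k T⟩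
    rw [survivingTree_cylinder, not_not.1 hT]
    simp
  refine measure_mono_null h ?_
  rw [measure_sUnion_null_iff (countable_cylinders.mono (Set.sep_subset _ _))]
  exact fun U hU => hU.2

theorem infinite_vertices_iff (T : PlanarTree) :
    T.vertices.Infinite ↔ ∀ k, T.offspring k ≠ [] := by
  refine ⟨fun h k => List.ne_nil_of_length_pos (T.length_pos h k), fun h => ?_⟩
  refine Set.infinite_of_injective_forall_mem (f := fun k : ℕ => (k, 0)) ?_ fun k => ?_
  · intro a b hab
    exact congrArg Prod.fst hab
  · exact List.length_pos_of_ne_nil (h k)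

theorem ae_infinite_vertices : ∀ᵐ T ∂survivingTree, T.vertices.Infinite := by
  simp only [infinite_vertices_iff]
  exact ae_all_iff.2 ae_offspring_ne_nil

theorem measurableSet_infinite_vertices : MeasurableSet {T : PlanarTree | T.vertices.Infinite} := by
  simp only [infinite_vertices_iff, Set.ofPred_forall]
  exact MeasurableSet.iInter fun k => (isOpen_setOf_offspring k (· ≠ [])).measurableSet

end PlanarTree

/-! ### Moments of the generation sizes -/

/-- The condition on `φ 0` covers `s = 0`, where the step is the point mass at `[]` and the right
side vanishes as `∞ * 0`. -/
theorem lintegral_survivingStep {φ : ℕ → ℝ≥0∞} (hφ : φ 0 = 0) (s : ℕ) :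
    ∫⁻ l, φ l.sum ∂(survivingStep s).toMeasure
      = (s : ℝ≥0∞)⁻¹ * ∑' l : {l : List ℕ // l.length = s},
          offspringWeight l * (l.1.sum * φ l.1.sum) := by
  by_cases hs : s = 0
  · rw [survivingStep, dif_pos hs, PMF.toMeasure_pure, lintegral_dirac]
    subst hs
    rw [tsum_length_zero fun l => offspringWeight l * (l.sum * φ l.sum)]
    simp [hφ]
  · rw [lintegral_countable']
    simp only [PMF.toMeasure_apply_singleton _ _ MeasurableSet.of_discrete]
    rw [survivingStep, dif_neg hs]
    simp only [sizeBiasedStep_apply]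
    rw [← ENNReal.tsum_mul_left]
    have := tsum_subtype {l : List ℕ | l.length = s}
      fun l => (s : ℝ≥0∞)⁻¹ * (offspringWeight l * (l.sum * φ l.sum))
    refine Eq.trans ?_ this.symm
    congr 1
    ext l
    by_cases hl : l.length = s
    · rw [Set.indicator_of_mem (by exact hl), Set.indicator_of_mem (by exact hl)]
      ring
    · rw [Set.indicator_of_notMem (by exact hl), Set.indicator_of_notMem (by exact hl), mul_zero]

/-- This is the Markov property, with a function of the first generation carried along. -/
theorem lintegral_survivingLaw_succ (k : ℕ) (g : List ℕ → ℝ≥0∞) (φ : ℕ → ℝ≥0∞) :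
    ∫⁻ f, g (f 0) * φ (f (k + 1)).sum ∂survivingLaw
      = ∫⁻ f, g (f 0) * ∫⁻ l, φ l.sum ∂(survivingStep (f k).sum).toMeasure ∂survivingLaw := by
  let F : ((i : Finset.Iic k) → (fun _ : ℕ => List ℕ) i) × List ℕ → ℝ≥0∞ :=
    fun p => g (p.1 ⟨0, by simp⟩) * φ p.2.sum
  have hF : Measurable F := Measurable.of_discrete
  have h1 : ∫⁻ f, g (f 0) * φ (f (k + 1)).sum ∂survivingLaw
      = ∫⁻ p, F p ∂(survivingLaw.map (fun f => (Preorder.frestrictLe k f, f (k + 1)))) := by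
    rw [lintegral_map hF (by fun_prop)]
    rfl
  rw [h1, ← survivingLaw_map_succ, Measure.lintegral_compProd hF,
    lintegral_map (Measurable.of_discrete (α := (i : Finset.Iic k) → (fun _ : ℕ => List ℕ) i))
      (by fun_prop)]
  congr 1
  ext f
  exact lintegral_const_mul (μ := (survivingStep (f k).sum).toMeasure) (g (f 0))
    (Measurable.of_discrete (f := fun l : List ℕ => φ l.sum))

/-- The extinction probability of the Galton-Watson process before generation `n`. -/
noncomputable def extinctProb (n : ℕ) : ℝ≥0∞ := ENNReal.ofReal ((n : ℝ) / (n + 1))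

/-- The offspring generating function is `1 / (2 - q)`. -/
theorem extinctProb_succ (n : ℕ) :
    ∑' j : ℕ, 2⁻¹ ^ (j + 1) * extinctProb n ^ j = extinctProb (n + 1) := by
  have hn : (0 : ℝ) < (n : ℝ) + 1 := by positivity
  have hr : ((n : ℝ) / (n + 1)) / 2 < 1 := by
    rw [div_div, div_lt_one (by positivity)]
    linarith
  have h := (hasSum_geometric_of_lt_one (by positivity) hr).mul_left 2⁻¹
  have h2 := ENNReal.ofReal_tsum_of_nonneg (fun j => by positivity) h.summable
  rw [h.tsum_eq] at h2
  have h3 : (2⁻¹ * (1 - (n : ℝ) / (n + 1) / 2)⁻¹) = ((n + 1 : ℕ) : ℝ) / ((n + 1 : ℕ) + 1) := by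
    have : 1 - (n : ℝ) / (n + 1) / 2 = (n + 2) / (2 * (n + 1)) := by
      field_simp
      ring
    rw [this]
    push_cast
    field_simp
    ring
  rw [h3] at h2
  rw [extinctProb, extinctProb, h2]
  congr 1
  ext j
  rw [ENNReal.ofReal_mul (by norm_num), div_eq_mul_inv _ (2 : ℝ),
    ENNReal.ofReal_pow (by positivity), ENNReal.ofReal_mul (by positivity),
    ENNReal.ofReal_inv_of_pos (by norm_num), ENNReal.ofReal_ofNat, mul_pow, pow_succ]
  ring

theorem extinctProb_le_one (n : ℕ) : extinctProb n ≤ 1 := by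
  rw [extinctProb, ENNReal.ofReal_le_one, div_le_one (by positivity)]
  linarith

theorem one_sub_extinctProb_pow_le (n s : ℕ) :
    1 - extinctProb n ^ s ≤ s * ((n : ℝ≥0∞) + 1)⁻¹ := by
  have h := one_add_mul_le_pow (a := -(1 / ((n : ℝ) + 1))) (by
    have : 1 / ((n : ℝ) + 1) ≤ 1 := by
      rw [div_le_one (by positivity)]
      linarith
    linarith) s
  have e : 1 + -(1 / ((n : ℝ) + 1)) = (n : ℝ) / (n + 1) := by
    field_simp
    ring
  rw [e] at h
  rw [extinctProb, ← ENNReal.ofReal_pow (by positivity), ← ENNReal.ofReal_one,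
    ← ENNReal.ofReal_sub _ (by positivity)]
  calc _ ≤ ENNReal.ofReal (s * (1 / ((n : ℝ) + 1))) := ENNReal.ofReal_le_ofReal (by linarith)
    _ = _ := by
      rw [ENNReal.ofReal_mul (by positivity), ENNReal.ofReal_natCast, one_div,
        ENNReal.ofReal_inv_of_pos (by positivity), ENNReal.ofReal_add (by positivity) (by norm_num),
        ENNReal.ofReal_natCast]

/-- The function of the generation size that turns the tree conditioned to survive forever into
the one conditioned to survive for `n` more generations. -/
noncomputable def survivalRatio (n s : ℕ) : ℝ≥0∞ := (1 - extinctProb n ^ s) * (s : ℝ≥0∞)⁻¹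

theorem mul_survivalRatio (n s : ℕ) : s * survivalRatio n s = 1 - extinctProb n ^ s := by
  unfold survivalRatio
  rcases Nat.eq_zero_or_pos s with rfl | hs
  · simp
  · rw [mul_comm, mul_assoc, ENNReal.inv_mul_cancel (by exact_mod_cast hs.ne') (by simp), mul_one]

/-- The size bias cancels the denominator `l.sum`. What remains is the unbiased mean of `1 - q ^
l.sum`, and the generating function of `s` independent vertices is an `s`-th power. -/
theorem lintegral_survivalRatio (n s : ℕ) :
    ∫⁻ l, survivalRatio n l.sum ∂(survivingStep s).toMeasure = survivalRatio (n + 1) s := by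
  rw [lintegral_survivingStep (by simp [survivalRatio])]
  simp only [mul_survivalRatio]
  rw [survivalRatio, mul_comm]
  congr 1
  have h (l : {l : List ℕ // l.length = s}) : offspringWeight l * (1 - extinctProb n ^ l.1.sum)
      = offspringWeight l - offspringWeight l * extinctProb n ^ l.1.sum := by
    rw [ENNReal.mul_sub, mul_one]
    intro _ _
    exact ENNReal.pow_ne_top (by simp)
  simp only [h]
  refine ENNReal.eq_sub_of_add_eq
    (ENNReal.pow_ne_top (ne_top_of_le_ne_top ENNReal.one_ne_top (extinctProb_le_one _))) ?_
  rw [← extinctProb_succ, ← tsum_offspringWeight_mul_pow, ← ENNReal.tsum_add]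
  conv_rhs => rw [← tsum_offspringWeight s]
  congr 1
  ext l
  exact tsub_add_cancel_of_le
    (mul_le_of_le_one_right' (pow_le_one₀ zero_le (extinctProb_le_one n)))

theorem lintegral_mul_survivalRatio (g : List ℕ → ℝ≥0∞) (k n : ℕ) :
    ∫⁻ f, g (f 0) * survivalRatio n (f k).sum ∂survivingLaw
      = ∫⁻ f, g (f 0) * survivalRatio (n + k) (f 0).sum ∂survivingLaw := by
  induction k generalizing n with
  | zero => rfl
  | succ k ih =>
    rw [lintegral_survivingLaw_succ]
    simp only [lintegral_survivalRatio]
    rw [ih, show n + 1 + k = n + (k + 1) by ring]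

/-- The first mean under the size bias is the second moment of the geometric law. -/
theorem lintegral_sum_zero_ne_top : ∫⁻ f, ((f 0).sum : ℝ≥0∞) ∂survivingLaw ≠ ∞ := by
  have h : ∫⁻ f, ((f 0).sum : ℝ≥0∞) ∂survivingLaw
      = ∫⁻ l, (l.sum : ℝ≥0∞) ∂(survivingLaw.map fun f => f 0) := by
    rw [lintegral_map Measurable.of_discrete (measurable_pi_apply 0)]
  rw [h, survivingLaw_map_zero, lintegral_survivingStep (φ := fun n => (n : ℝ≥0∞)) (by simp),
    tsum_length_succ 0 fun l => offspringWeight l * (l.sum * l.sum)]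
  have h2 (j : ℕ) : ∑' l : {l : List ℕ // l.length = 0},
      offspringWeight (j :: l.1) * (((j :: l.1).sum : ℕ) * ((j :: l.1).sum : ℕ))
      = ENNReal.ofReal (2⁻¹ * ((j : ℝ) ^ 2 * 2⁻¹ ^ j)) := by
    rw [tsum_length_zero fun l => offspringWeight (j :: l) * ((j :: l).sum * (j :: l).sum),
      ENNReal.ofReal_mul (by norm_num), ENNReal.ofReal_mul (by positivity),
      ENNReal.ofReal_pow (by positivity), ENNReal.ofReal_pow (by norm_num),
      ENNReal.ofReal_inv_of_pos (by norm_num), ENNReal.ofReal_natCast, ENNReal.ofReal_ofNat,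
      offspringWeight_cons]
    simp [offspringWeight]
    ring
  simp only [h2]
  have h3 := (summable_pow_mul_geometric_of_norm_lt_one 2 (r := (2⁻¹ : ℝ))
    (by norm_num)).mul_left 2⁻¹
  rw [← ENNReal.ofReal_tsum_of_nonneg (fun j => by positivity) h3]
  finiteness

namespace PlanarTree

theorem survivingTree_map_offspring : survivingTree.map offspring = survivingLaw := by
  rw [survivingTree, measurableEmbedding_offspring.map_comap]
  exact Measure.restrict_eq_self_of_ae_mem ae_mem_range_offspring

theorem lintegral_survivingTree {F : (ℕ → List ℕ) → ℝ≥0∞} (hF : Measurable F) :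
    ∫⁻ T, F T.offspring ∂survivingTree = ∫⁻ f, F f ∂survivingLaw := by
  rw [← survivingTree_map_offspring, lintegral_map hF measurableEmbedding_offspring.measurable]

theorem lintegral_length_one :
    ∫⁻ T, ((T.offspring 1).length : ℝ≥0∞) ∂survivingTree
      = ∫⁻ f, ((f 0).sum : ℝ≥0∞) ∂survivingLaw := by
  simp only [length_succ]
  exact lintegral_survivingTree (F := fun f => ((f 0).sum : ℝ≥0∞))
    (Measurable.comp (g := fun l : List ℕ => (l.sum : ℝ≥0∞)) Measurable.of_discrete
      (measurable_pi_apply 0))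

/-- The mean of the quotient of the sizes of the second and the `n + 2`-nd generation. -/
theorem lintegral_length_ratio_le (n : ℕ) :
    ∫⁻ T, ((T.offspring 1).length : ℝ≥0∞) * ((T.offspring (n + 1)).length : ℝ≥0∞)⁻¹ ∂survivingTree
      ≤ (∫⁻ T, ((T.offspring 1).length : ℝ≥0∞) ∂survivingTree) * ((n : ℝ≥0∞) + 1)⁻¹ := by
  have hm (F : List ℕ → ℝ≥0∞) (k : ℕ) : Measurable fun f : ℕ → List ℕ => F (f k) :=
    Measurable.comp (g := F) Measurable.of_discrete (measurable_pi_apply k)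
  -- Since `extinctProb 0 = 0`, the ratio `survivalRatio 0 s` is `s⁻¹` for `s ≠ 0`.
  have h1 : ∫⁻ T, ((T.offspring 1).length : ℝ≥0∞) * ((T.offspring (n + 1)).length : ℝ≥0∞)⁻¹
        ∂survivingTree
      = ∫⁻ T, ((T.offspring 0).sum : ℝ≥0∞) * survivalRatio 0 (T.offspring n).sum ∂survivingTree := by
    refine lintegral_congr_ae ?_
    filter_upwards [ae_offspring_ne_nil (n + 1)] with T hT
    have : (T.offspring n).sum ≠ 0 := by
      rw [← T.length_succ]
      exact fun h => hT (List.eq_nil_of_length_eq_zero h)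
    simp [length_succ, survivalRatio, extinctProb, this]
  rw [h1, lintegral_length_one, lintegral_survivingTree
    (F := fun f => ((f 0).sum : ℝ≥0∞) * survivalRatio 0 (f n).sum)
    ((hm (fun l => (l.sum : ℝ≥0∞)) 0).mul (hm (fun l => survivalRatio 0 l.sum) n)),
    lintegral_mul_survivalRatio fun l => (l.sum : ℝ≥0∞), zero_add,
    ← lintegral_mul_const _ (hm (fun l => (l.sum : ℝ≥0∞)) 0)]
  refine lintegral_mono fun f => ?_
  simp only [mul_survivalRatio]
  exact one_sub_extinctProb_pow_le n _

/-! ### The moments of the radial graphs -/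

/-- The properties of the reduced ensembles from which their spectral dimension is found. -/
structure MomentBounds (χ : Measure RadialGraph) (C : ℝ≥0∞) : Prop where
  isProbabilityMeasure : IsProbabilityMeasure χ
  ne_top : C ≠ ∞
  lintegral_zero_le : ∫⁻ G, ((G 0 : ℕ) : ℝ≥0∞) ∂χ ≤ C
  lintegral_ratio_le : ∀ n : ℕ,
    ∫⁻ G, ((G 0 : ℕ) : ℝ≥0∞) * ((G n : ℕ) : ℝ≥0∞)⁻¹ ∂χ ≤ C * ((n : ℝ≥0∞) + 1)⁻¹

theorem measurable_natCast_apply (n : ℕ) :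
    Measurable fun G : RadialGraph => ((G n : ℕ) : ℝ≥0∞) :=
  Measurable.comp (g := fun n : ℕ+ => ((n : ℕ) : ℝ≥0∞)) measurable_from_top (measurable_pi_apply n)

theorem measurable_length (k : ℕ) : Measurable fun T : PlanarTree => (T.offspring k).length :=
  Measurable.comp (g := List.length) measurable_from_top (measurable_offspring k)

theorem measurable_radialGraph {c : InfinitePlanarTree → RadialGraph}
    (h : ∀ k, Measurable fun T => (c T k : ℕ)) : Measurable c := by
  refine measurable_pi_iff.2 fun k => ?_
  have : (fun T => c T k) = Nat.toPNat' ∘ fun T => (c T k : ℕ) := by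
    ext1 T
    exact (PNat.coe_toPNat' _).symm
  rw [this]
  exact measurable_from_top.comp (h k)

theorem measurable_collapse : Measurable collapse := by
  refine measurable_radialGraph fun k => ?_
  simp only [collapse, PNat.mk_coe, ncard_slice]
  split_ifs with hk
  · exact ((measurable_length (k + 1)).comp measurable_subtype_coe).const_add 0
  · exact ((measurable_length k).comp measurable_subtype_coe).add
      ((measurable_length (k + 1)).comp measurable_subtype_coe)

theorem measurable_collapse' : Measurable collapse' := by
  refine measurable_radialGraph fun k => ?_
  simp only [collapse', PNat.mk_coe, ncard_treeSlice]
  exact (measurable_length (k + 1)).comp measurable_subtype_coe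

theorem lintegral_comap_subtype_le (F : PlanarTree → ℝ≥0∞) :
    ∫⁻ T : InfinitePlanarTree, F T ∂(survivingTree.comap Subtype.val)
      ≤ ∫⁻ T, F T ∂survivingTree :=
  (lintegral_subtype_comap measurableSet_infinite_vertices F).trans_le
    (setLIntegral_le_lintegral _ _)

theorem momentBounds_map {c : InfinitePlanarTree → RadialGraph} (hc : Measurable c)
    (h0 : ∀ T, (c T 0 : ℕ) = (T.1.offspring 1).length)
    (h : ∀ T n, (T.1.offspring (n + 1)).length ≤ (c T n : ℕ)) :
    MomentBounds ((survivingTree.comap (Subtype.val : InfinitePlanarTree → PlanarTree)).map c)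
      (∫⁻ T, ((T.offspring 1).length : ℝ≥0∞) ∂survivingTree) where
  isProbabilityMeasure := by
    refine ⟨?_⟩
    rw [Measure.map_apply hc MeasurableSet.univ, Set.preimage_univ]
    refine ((MeasurableEmbedding.subtype_coe measurableSet_infinite_vertices).comap_apply
      survivingTree Set.univ).trans ?_
    rw [Set.image_univ, Subtype.range_coe]
    exact prob_compl_eq_zero_iff measurableSet_infinite_vertices |>.1 ae_infinite_vertices
  ne_top := by
    rw [lintegral_length_one]
    exact lintegral_sum_zero_ne_top
  lintegral_zero_le := by
    rw [lintegral_map (measurable_natCast_apply 0) hc]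
    simp only [h0]
    exact lintegral_comap_subtype_le fun T => ((T.offspring 1).length : ℝ≥0∞)
  lintegral_ratio_le n := by
    have hm : Measurable fun G : RadialGraph => ((G 0 : ℕ) : ℝ≥0∞) * ((G n : ℕ) : ℝ≥0∞)⁻¹ :=
      (measurable_natCast_apply 0).mul (measurable_natCast_apply n).inv
    rw [lintegral_map hm hc]
    refine le_trans ?_ ((lintegral_comap_subtype_le _).trans (lintegral_length_ratio_le n))
    refine lintegral_mono fun T => ?_
    simp only [h0]
    gcongr
    exact h T n

theorem exists_momentBounds {χ : Measure RadialGraph}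
    (hχ : χ = chiR survivingTree ∨ χ = chiR' survivingTree) : ∃ C, MomentBounds χ C := by
  rcases hχ with rfl | rfl
  · refine ⟨_, momentBounds_map measurable_collapse (fun T => ?_) fun T n => ?_⟩
    · simp [collapse, ncard_slice]
    · simp only [collapse, PNat.mk_coe, ncard_slice]
      exact Nat.le_add_left _ _
  · refine ⟨_, momentBounds_map measurable_collapse' (fun T => ?_) fun T n => ?_⟩
    · simp [collapse', ncard_treeSlice]
    · simp only [collapse', PNat.mk_coe, ncard_treeSlice]
      exact le_rfl

end PlanarTree

namespace RadialGraph

/-! ### Random walk on a radial graph -/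

theorem degree_zero (G : RadialGraph) : G.degree 0 = G 0 := by
  simp [degree, edges]

theorem degree_succ (G : RadialGraph) (n : ℕ) : G.degree (n + 1) = G n + G (n + 1) := by
  rw [degree, Finset.sum_eq_add_of_mem n (n + 2) (by simp; omega) (by simp) (by omega)]
  · simp [edges, show ¬ n = n + 1 + 1 by omega]
  · rintro m - ⟨h1, h2⟩
    simp only [edges]
    rw [if_neg (by omega), if_neg (by omega)]

theorem one_le_degree (G : RadialGraph) (n : ℕ) : 1 ≤ G.degree n := by
  cases n with
  | zero =>
    rw [degree_zero]
    exact (G 0).pos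
  | succ n =>
    rw [degree_succ]
    exact (G n).pos.trans_le (Nat.le_add_right _ _)

theorem walkProb_succ_zero (G : RadialGraph) (t : ℕ) :
    G.walkProb (t + 1) 0 = G.walkProb t 1 * (((G 0 : ℕ) : ℝ) / G.degree 1) := by
  simp [walkProb, edges, Finset.sum_range_succ]

theorem walkProb_succ_succ (G : RadialGraph) (t n : ℕ) :
    G.walkProb (t + 1) (n + 1) = G.walkProb t n * (((G n : ℕ) : ℝ) / G.degree n)
      + G.walkProb t (n + 2) * (((G (n + 1) : ℕ) : ℝ) / G.degree (n + 2)) := by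
  rw [walkProb, Finset.sum_eq_add_of_mem n (n + 2) (by simp; omega) (by simp) (by omega)]
  · simp [edges]
  · rintro m - ⟨h1, h2⟩
    simp only [edges]
    rw [if_neg (by omega), if_neg (by omega)]
    simp

theorem walkProb_nonneg (G : RadialGraph) (t n : ℕ) : 0 ≤ G.walkProb t n := by
  induction t generalizing n with
  | zero =>
    rw [walkProb]
    split_ifs <;> norm_num
  | succ t ih =>
    rw [walkProb]
    exact Finset.sum_nonneg fun m _ => mul_nonneg (ih m) (by positivity)

theorem walkProb_eq_add (G : RadialGraph) (t n : ℕ) :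
    G.walkProb t (n + 1) = G.walkProb t (n + 1) * (((G (n + 1) : ℕ) : ℝ) / G.degree (n + 1))
      + G.walkProb t (n + 1) * (((G n : ℕ) : ℝ) / G.degree (n + 1)) := by
  have h : (0 : ℝ) < G.degree (n + 1) := by exact_mod_cast G.one_le_degree (n + 1)
  rw [← mul_add, ← add_div, degree_succ]
  rw [degree_succ] at h
  push_cast at h ⊢
  rw [add_comm ((G (n + 1) : ℕ) : ℝ), div_self h.ne', mul_one]

/-- Conservation of mass in a finite window: the two extra terms are the upward moves from `M` and
`M + 1`, which end outside `{0, ..., M}`. -/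
theorem sum_walkProb_succ (G : RadialGraph) (t M : ℕ) :
    ∑ n ∈ Finset.range (M + 1), G.walkProb (t + 1) n
        + G.walkProb t M * (((G M : ℕ) : ℝ) / G.degree M)
        + G.walkProb t (M + 1) * (((G (M + 1) : ℕ) : ℝ) / G.degree (M + 1))
      = ∑ n ∈ Finset.range (M + 2), G.walkProb t n := by
  induction M with
  | zero =>
    have h : (0 : ℝ) < (G 0 : ℕ) := by exact_mod_cast (G 0).pos
    have h1 := G.walkProb_eq_add t 0
    simp only [zero_add] at h1 ⊢
    rw [Finset.sum_range_one, Finset.sum_range_succ, Finset.sum_range_one, walkProb_succ_zero,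
      degree_zero, div_self h.ne']
    linarith
  | succ M ih =>
    have h1 := G.walkProb_eq_add t (M + 1)
    have h2 := G.walkProb_succ_succ t M
    rw [Finset.sum_range_succ _ (M + 2), ← ih, Finset.sum_range_succ _ (M + 1)]
    simp only [add_assoc, Nat.reduceAdd] at h1 h2 ⊢
    linarith

theorem sum_walkProb_le_one (G : RadialGraph) (t M : ℕ) :
    ∑ n ∈ Finset.range M, G.walkProb t n ≤ 1 := by
  induction t generalizing M with
  | zero =>
    simp only [walkProb, Finset.sum_ite_eq']
    split_ifs <;> norm_num
  | succ t ih =>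
    have h1 := G.sum_walkProb_succ t M
    have h2 := ih (M + 2)
    have h3 := G.walkProb_nonneg t M
    have h4 := G.walkProb_nonneg t (M + 1)
    have h5 := G.walkProb_nonneg (t + 1) M
    have h6 : 0 ≤ G.walkProb t M * (((G M : ℕ) : ℝ) / G.degree M) := by positivity
    have h7 : 0 ≤ G.walkProb t (M + 1) * (((G (M + 1) : ℕ) : ℝ) / G.degree (M + 1)) := by positivity
    rw [Finset.sum_range_succ] at h1
    linarith

theorem walkProb_le_one (G : RadialGraph) (t n : ℕ) : G.walkProb t n ≤ 1 :=
  (Finset.single_le_sum (fun m _ => G.walkProb_nonneg t m) (Finset.self_mem_range_succ n)).trans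
    (G.sum_walkProb_le_one t (n + 1))

/-- The Green function of random walk from the root which survives each step with probability
`c`. -/
noncomputable def green (G : RadialGraph) (c : ℝ) (n : ℕ) : ℝ := ∑' t, c ^ t * G.walkProb t n

theorem summable_green (G : RadialGraph) {c : ℝ} (hc0 : 0 ≤ c) (hc1 : c < 1) (n : ℕ) :
    Summable fun t => c ^ t * G.walkProb t n := by
  refine Summable.of_nonneg_of_le (fun t => mul_nonneg (by positivity) (G.walkProb_nonneg t n))
    (fun t => ?_) (summable_geometric_of_lt_one hc0 hc1)
  exact mul_le_of_le_one_right (by positivity) (G.walkProb_le_one t n)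

theorem green_nonneg (G : RadialGraph) {c : ℝ} (hc0 : 0 ≤ c) (n : ℕ) : 0 ≤ G.green c n :=
  tsum_nonneg fun t => mul_nonneg (by positivity) (G.walkProb_nonneg t n)

theorem sum_green_le (G : RadialGraph) {c : ℝ} (hc0 : 0 ≤ c) (hc1 : c < 1) (M : ℕ) :
    ∑ n ∈ Finset.range M, G.green c n ≤ (1 - c)⁻¹ := by
  simp only [green]
  rw [← Summable.tsum_finsetSum fun n _ => G.summable_green hc0 hc1 n,
    ← tsum_geometric_of_lt_one hc0 hc1]
  refine Summable.tsum_le_tsum (fun t => ?_) (summable_sum fun n _ => G.summable_green hc0 hc1 n)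
    (summable_geometric_of_lt_one hc0 hc1)
  rw [← Finset.mul_sum]
  exact mul_le_of_le_one_right (by positivity) (G.sum_walkProb_le_one t M)

theorem green_zero (G : RadialGraph) {c : ℝ} (hc0 : 0 ≤ c) (hc1 : c < 1) :
    G.green c 0 = 1 + c * (G.green c 1 * (((G 0 : ℕ) : ℝ) / G.degree 1)) := by
  rw [green, (G.summable_green hc0 hc1 0).tsum_eq_zero_add, green, ← tsum_mul_right,
    ← tsum_mul_left]
  simp only [walkProb_succ_zero]
  congr 1
  · simp [walkProb]
  · congr 1
    ext t
    ring

theorem green_succ (G : RadialGraph) {c : ℝ} (hc0 : 0 ≤ c) (hc1 : c < 1) (n : ℕ) :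
    G.green c (n + 1) = c * (G.green c n * (((G n : ℕ) : ℝ) / G.degree n)
      + G.green c (n + 2) * (((G (n + 1) : ℕ) : ℝ) / G.degree (n + 2))) := by
  rw [green, (G.summable_green hc0 hc1 (n + 1)).tsum_eq_zero_add, green, green, ← tsum_mul_right,
    ← tsum_mul_right, ← ((G.summable_green hc0 hc1 n).mul_right _).tsum_add
      ((G.summable_green hc0 hc1 (n + 2)).mul_right _), ← tsum_mul_left]
  simp only [walkProb_succ_succ]
  rw [show c ^ 0 * G.walkProb 0 (n + 1) = 0 by simp [walkProb], zero_add]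
  congr 1
  ext t
  ring

/-- The Green function divided by the invariant measure. -/
noncomputable def potential (G : RadialGraph) (c : ℝ) (n : ℕ) : ℝ := G.green c n / G.degree n

/-- The expected number of crossings of the edges from `n` to `n + 1`, counted with orientation. -/
noncomputable def flow (G : RadialGraph) (c : ℝ) (n : ℕ) : ℝ :=
  c * ((G n : ℕ) : ℝ) * (G.potential c n - G.potential c (n + 1))

theorem degree_pos (G : RadialGraph) (n : ℕ) : (0 : ℝ) < G.degree n := by
  exact_mod_cast G.one_le_degree n

theorem degree_mul_potential (G : RadialGraph) (c : ℝ) (n : ℕ) :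
    G.degree n * G.potential c n = G.green c n :=
  mul_div_cancel₀ _ (G.degree_pos n).ne'

theorem potential_le_green (G : RadialGraph) {c : ℝ} (hc0 : 0 ≤ c) (n : ℕ) :
    G.potential c n ≤ G.green c n :=
  div_le_self (G.green_nonneg hc0 n) (by exact_mod_cast G.one_le_degree n)

theorem flow_zero (G : RadialGraph) {c : ℝ} (hc0 : 0 ≤ c) (hc1 : c < 1) :
    G.flow c 0 = 1 - (1 - c) * G.green c 0 := by
  have h := G.green_zero hc0 hc1
  have h1 := G.degree_mul_potential c 0
  rw [degree_zero] at h1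
  have h2 : G.green c 1 * (((G 0 : ℕ) : ℝ) / G.degree 1) = (G 0 : ℕ) * G.potential c 1 := by
    rw [potential]
    ring
  rw [h2] at h
  rw [flow, zero_add]
  linear_combination c * h1 + h

theorem flow_succ (G : RadialGraph) {c : ℝ} (hc0 : 0 ≤ c) (hc1 : c < 1) (n : ℕ) :
    G.flow c (n + 1) = G.flow c n - (1 - c) * G.green c (n + 1) := by
  have h := G.green_succ hc0 hc1 n
  have h1 := G.degree_mul_potential c (n + 1)
  rw [degree_succ] at h1
  push_cast at h1
  have h2 : G.green c n * (((G n : ℕ) : ℝ) / G.degree n) = (G n : ℕ) * G.potential c n := by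
    rw [potential]
    ring
  have h3 : G.green c (n + 2) * (((G (n + 1) : ℕ) : ℝ) / G.degree (n + 2))
      = (G (n + 1) : ℕ) * G.potential c (n + 2) := by
    rw [potential]
    ring
  rw [h2, h3] at h
  simp only [flow]
  linear_combination c * h1 + h

/-- A unit of mass enters at the root; what does not pass beyond `N` is killed in `{0, ..., N}`. -/
theorem flow_eq (G : RadialGraph) {c : ℝ} (hc0 : 0 ≤ c) (hc1 : c < 1) (N : ℕ) :
    G.flow c N = 1 - (1 - c) * ∑ n ∈ Finset.range (N + 1), G.green c n := by
  induction N with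
  | zero => rw [flow_zero G hc0 hc1, zero_add, Finset.sum_range_one]
  | succ N ih =>
    rw [flow_succ G hc0 hc1, ih, Finset.sum_range_succ _ (N + 1)]
    ring

theorem flow_nonneg (G : RadialGraph) {c : ℝ} (hc0 : 0 ≤ c) (hc1 : c < 1) (N : ℕ) :
    0 ≤ G.flow c N := by
  rw [flow_eq G hc0 hc1]
  have h := mul_le_mul_of_nonneg_left (G.sum_green_le hc0 hc1 (N + 1)) (sub_nonneg.2 hc1.le)
  rw [mul_inv_cancel₀ (sub_pos.2 hc1).ne'] at h
  linarith

theorem flow_le_one (G : RadialGraph) {c : ℝ} (hc0 : 0 ≤ c) (hc1 : c < 1) (N : ℕ) :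
    G.flow c N ≤ 1 := by
  rw [flow_eq G hc0 hc1]
  have h : 0 ≤ ∑ n ∈ Finset.range (N + 1), G.green c n :=
    Finset.sum_nonneg fun n _ => G.green_nonneg hc0 n
  have := mul_nonneg (sub_nonneg.2 hc1.le) h
  linarith

theorem potential_sub (G : RadialGraph) {c : ℝ} (hc0 : 0 < c) (n : ℕ) :
    G.potential c n - G.potential c (n + 1) = G.flow c n * (c⁻¹ * ((G n : ℕ) : ℝ)⁻¹) := by
  have : ((G n : ℕ) : ℝ) ≠ 0 := by exact_mod_cast (G n).ne_zero
  rw [flow]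
  field_simp

theorem potential_antitone (G : RadialGraph) {c : ℝ} (hc0 : 0 < c) (hc1 : c < 1) :
    Antitone (G.potential c) := by
  refine antitone_nat_of_succ_le fun n => ?_
  rw [← sub_nonneg, potential_sub G hc0]
  exact mul_nonneg (G.flow_nonneg hc0.le hc1 n) (by positivity)

/-- The total Green mass is at most `(1 - c)⁻¹`, and each of the `N + 1` vertices up to `N` carries
at least `potential c N`, by monotonicity and because degrees are at least `1`. -/
theorem potential_le (G : RadialGraph) {c : ℝ} (hc0 : 0 < c) (hc1 : c < 1) (N : ℕ) :
    G.potential c N ≤ ((1 - c) * (N + 1))⁻¹ := by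
  have h1 : ((N : ℝ) + 1) * G.potential c N ≤ ∑ n ∈ Finset.range (N + 1), G.green c n := by
    calc ((N : ℝ) + 1) * G.potential c N = ∑ n ∈ Finset.range (N + 1), G.potential c N := by
          simp
      _ ≤ _ := Finset.sum_le_sum fun n hn => (G.potential_antitone hc0 hc1
          (Nat.lt_succ_iff.1 (Finset.mem_range.1 hn))).trans (G.potential_le_green hc0.le n)
  have h2 := h1.trans (G.sum_green_le hc0.le hc1 (N + 1))
  rw [mul_inv, ← div_eq_mul_inv, le_div_iff₀ (by positivity), mul_comm]
  exact h2

/-- Ohm's law: a flow of at most `1` crosses each resistance, so the potential drop up to `N` is at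
most the effective resistance, up to the factor `c⁻¹`. -/
theorem potential_zero_le (G : RadialGraph) {c : ℝ} (hc0 : 0 < c) (hc1 : c < 1) (N : ℕ) :
    G.potential c 0 ≤ c⁻¹ * ∑ n ∈ Finset.range N, ((G n : ℕ) : ℝ)⁻¹ + ((1 - c) * (N + 1))⁻¹ := by
  have h1 : G.potential c 0 - G.potential c N
      ≤ c⁻¹ * ∑ n ∈ Finset.range N, ((G n : ℕ) : ℝ)⁻¹ := by
    rw [← Finset.sum_range_sub', Finset.mul_sum]
    refine Finset.sum_le_sum fun n _ => ?_
    rw [potential_sub G hc0]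
    exact mul_le_of_le_one_left (by positivity) (G.flow_le_one hc0.le hc1 n)
  have := G.potential_le hc0 hc1 N
  linarith

/-! ### Bounds for the generating function of the return probabilities, and its measurability. -/

theorem Q_eq_green (G : RadialGraph) {x : ℝ} (hx : x ∈ Set.Ioo (0 : ℝ) 1) :
    G.Q x = G.green (√(1 - x)) 0 := by
  have h1 : √(1 - x) < 1 := by
    rw [Real.sqrt_lt' one_pos]
    linarith [hx.1]
  rw [Q, green, (G.summable_green (Real.sqrt_nonneg _) h1 0).tsum_eq_zero_add]
  congr 1
  · simp [walkProb]
  · congr 1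
    ext t
    rw [Real.rpow_div_two_eq_sqrt _ (by linarith [hx.2]), Real.rpow_natCast]
    rfl

theorem one_le_Q (G : RadialGraph) {x : ℝ} (hx : x ∈ Set.Ioo (0 : ℝ) 1) : 1 ≤ G.Q x := by
  rw [Q, le_add_iff_nonneg_right]
  exact tsum_nonneg fun t => mul_nonneg (Real.rpow_nonneg (by linarith [hx.2]) _)
    (G.walkProb_nonneg _ 0)

theorem sqrt_one_sub_bounds {x : ℝ} (hx : x ∈ Set.Ioo (0 : ℝ) 1) :
    0 < √(1 - x) ∧ √(1 - x) < 1 ∧ x / 2 ≤ 1 - √(1 - x) := by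
  have h0 : 0 < √(1 - x) := Real.sqrt_pos.2 (by linarith [hx.2])
  have h := Real.sq_sqrt (show 0 ≤ 1 - x by linarith [hx.2])
  refine ⟨h0, ?_, ?_⟩
  · nlinarith [hx.1]
  · nlinarith [sq_nonneg (√(1 - x) - 1)]

theorem Q_le (G : RadialGraph) {x : ℝ} (hx : x ∈ Set.Ioo (0 : ℝ) 1) : G.Q x ≤ 2 / x := by
  obtain ⟨h0, h1, h2⟩ := sqrt_one_sub_bounds hx
  have h := G.sum_green_le h0.le h1 1
  rw [Finset.sum_range_one, ← Q_eq_green G hx] at h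
  refine h.trans ?_
  rw [← inv_div]
  exact inv_anti₀ (by linarith [hx.1]) h2

theorem Q_le_sum (G : RadialGraph) {x : ℝ} (hx : x ∈ Set.Ioo (0 : ℝ) 1) (hx' : x ≤ 1 / 2) {N : ℕ}
    (hN : 1 / x ≤ N + 1) :
    G.Q x ≤ 2 * ∑ n ∈ Finset.range N, ((G 0 : ℕ) : ℝ) * ((G n : ℕ) : ℝ)⁻¹
      + 2 * ((G 0 : ℕ) : ℝ) := by
  obtain ⟨h0, h1, h2⟩ := sqrt_one_sub_bounds hx
  have h3 := G.potential_zero_le h0 h1 N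
  rw [Q_eq_green G hx, ← degree_mul_potential, degree_zero, ← Finset.mul_sum]
  have h4 : (√(1 - x))⁻¹ ≤ 2 := by
    rw [inv_le_comm₀ h0 (by norm_num)]
    refine Real.le_sqrt_of_sq_le ?_
    linarith
  -- The killing rate is at least `x / 2` and `N + 1` is at least `1 / x`, so the remaining
  -- potential at `N` is bounded.
  have h5 : ((1 - √(1 - x)) * (N + 1))⁻¹ ≤ 2 := by
    rw [inv_le_comm₀ (mul_pos (by linarith) (by positivity)) (by norm_num)]
    rw [div_le_iff₀ hx.1] at hN
    nlinarith
  have h6 : (√(1 - x))⁻¹ * ∑ n ∈ Finset.range N, ((G n : ℕ) : ℝ)⁻¹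
      ≤ 2 * ∑ n ∈ Finset.range N, ((G n : ℕ) : ℝ)⁻¹ :=
    mul_le_mul_of_nonneg_right h4 (Finset.sum_nonneg fun n _ => by positivity)
  calc _ ≤ ((G 0 : ℕ) : ℝ) * (2 * ∑ n ∈ Finset.range N, ((G n : ℕ) : ℝ)⁻¹ + 2) :=
        mul_le_mul_of_nonneg_left (by linarith) (by positivity)
    _ = _ := by ring

theorem measurable_edges (m n : ℕ) : Measurable fun G : RadialGraph => (G.edges m n : ℝ) := by
  have h (k : ℕ) : Measurable fun G : RadialGraph => ((G k : ℕ) : ℝ) :=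
    Measurable.comp (g := fun n : ℕ+ => ((n : ℕ) : ℝ)) measurable_from_top (measurable_pi_apply k)
  unfold edges
  split_ifs
  · exact h m
  · exact h n
  · exact measurable_const

theorem measurable_degree (n : ℕ) : Measurable fun G : RadialGraph => (G.degree n : ℝ) := by
  simp only [degree, Nat.cast_sum]
  exact Finset.measurable_sum _ fun m _ => measurable_edges n m

theorem measurable_walkProb (t n : ℕ) : Measurable fun G : RadialGraph => G.walkProb t n := by
  induction t generalizing n with
  | zero =>
    simp only [walkProb]
    exact measurable_const
  | succ t ih =>
    simp only [walkProb]
    exact Finset.measurable_sum _ fun m _ =>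
      (ih m).mul ((measurable_edges m n).div (measurable_degree m))

theorem measurable_Q {x : ℝ} (hx : x ∈ Set.Ioo (0 : ℝ) 1) :
    Measurable fun G : RadialGraph => G.Q x := by
  obtain ⟨h0, h1, -⟩ := sqrt_one_sub_bounds hx
  simp only [fun G => Q_eq_green G hx]
  refine measurable_of_tendsto_metrizable (f := fun N (G : RadialGraph) =>
    ∑ t ∈ Finset.range N, √(1 - x) ^ t * G.walkProb t 0) (fun N => ?_)
    (tendsto_pi_nhds.2 fun G => (G.summable_green h0.le h1 0).hasSum.tendsto_sum_nat)
  exact Finset.measurable_sum _ fun t _ => (measurable_walkProb t 0).const_mul _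

end RadialGraph

namespace PlanarTree

/-! ### The spectral dimension -/

theorem MomentBounds.lintegral_Q_le {χ : Measure RadialGraph} {C : ℝ≥0∞} (h : MomentBounds χ C)
    {x : ℝ} (hx : x ∈ Set.Ioo (0 : ℝ) 1) (hx' : x ≤ 1 / 2) :
    ∫⁻ G, ENNReal.ofReal (RadialGraph.Q G x) ∂χ
      ≤ ENNReal.ofReal (2 * C.toReal * (3 + |Real.log x|)) := by
  -- At this cutoff the remaining potential is bounded, while the harmonic sum coming from the
  -- moment bounds is still only logarithmic in `x`.
  set N := ⌈1 / x⌉₊ with hN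
  have hx0 := hx.1
  have hN1 : 1 / x ≤ N := Nat.le_ceil _
  have hNx : (N : ℝ) ≤ 2 / x := by
    have := (Nat.ceil_lt_add_one (show 0 ≤ 1 / x by positivity)).le
    have h1 : 1 ≤ 1 / x := by
      rw [le_div_iff₀ hx0]
      linarith
    calc (N : ℝ) ≤ 1 / x + 1 / x := by linarith
      _ = 2 / x := by ring
  have hNpos : (0 : ℝ) < N := lt_of_lt_of_le (by positivity) hN1
  have hharm : ∑ n ∈ Finset.range N, ((n : ℝ) + 1)⁻¹ ≤ 2 + |Real.log x| := by
    have h1 := harmonic_le_one_add_log N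
    have h2 : ((harmonic N : ℚ) : ℝ) = ∑ n ∈ Finset.range N, ((n : ℝ) + 1)⁻¹ := by
      simp [harmonic]
    have h3 : Real.log N ≤ 1 + |Real.log x| := by
      calc Real.log N ≤ Real.log (2 / x) := Real.log_le_log hNpos hNx
        _ = Real.log 2 - Real.log x := Real.log_div (by norm_num) hx0.ne'
        _ ≤ 1 + |Real.log x| := by
          have := neg_le_abs (Real.log x)
          have := Real.log_two_lt_d9
          linarith
    rw [← h2]
    linarith
  have hpoint (G : RadialGraph) : ENNReal.ofReal (RadialGraph.Q G x)
      ≤ 2 * ∑ n ∈ Finset.range N, ((G 0 : ℕ) : ℝ≥0∞) * ((G n : ℕ) : ℝ≥0∞)⁻¹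
        + 2 * ((G 0 : ℕ) : ℝ≥0∞) := by
    refine (ENNReal.ofReal_le_ofReal (G.Q_le_sum hx hx' (N := N) (by linarith))).trans_eq ?_
    have hG (n : ℕ) : ENNReal.ofReal (((G 0 : ℕ) : ℝ) * ((G n : ℕ) : ℝ)⁻¹)
        = ((G 0 : ℕ) : ℝ≥0∞) * ((G n : ℕ) : ℝ≥0∞)⁻¹ := by
      rw [ENNReal.ofReal_mul (by positivity), ENNReal.ofReal_inv_of_pos
        (by exact_mod_cast (G n).pos), ENNReal.ofReal_natCast, ENNReal.ofReal_natCast]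
    rw [ENNReal.ofReal_add (by positivity) (by positivity), ENNReal.ofReal_mul (by norm_num),
      ENNReal.ofReal_mul (by norm_num), ENNReal.ofReal_sum_of_nonneg fun n _ => by positivity]
    simp only [hG, ENNReal.ofReal_natCast, ENNReal.ofReal_ofNat]
  have hm (n : ℕ) : Measurable fun G : RadialGraph =>
      ((G 0 : ℕ) : ℝ≥0∞) * ((G n : ℕ) : ℝ≥0∞)⁻¹ :=
    (measurable_natCast_apply 0).mul (measurable_natCast_apply n).inv
  have hC : C = ENNReal.ofReal C.toReal := (ENNReal.ofReal_toReal h.ne_top).symm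
  calc ∫⁻ G, ENNReal.ofReal (RadialGraph.Q G x) ∂χ
      ≤ ∫⁻ G, (2 * ∑ n ∈ Finset.range N, ((G 0 : ℕ) : ℝ≥0∞) * ((G n : ℕ) : ℝ≥0∞)⁻¹
        + 2 * ((G 0 : ℕ) : ℝ≥0∞)) ∂χ := lintegral_mono hpoint
    _ = 2 * ∑ n ∈ Finset.range N, ∫⁻ G, ((G 0 : ℕ) : ℝ≥0∞) * ((G n : ℕ) : ℝ≥0∞)⁻¹ ∂χ
        + 2 * ∫⁻ G, ((G 0 : ℕ) : ℝ≥0∞) ∂χ := by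
      rw [lintegral_add_right _ ((measurable_natCast_apply 0).const_mul 2),
        lintegral_const_mul _ (Finset.measurable_sum _ fun n _ => hm n),
        lintegral_const_mul _ (measurable_natCast_apply 0),
        lintegral_finsetSum _ fun n _ => hm n]
    _ ≤ 2 * ∑ n ∈ Finset.range N, C * ((n : ℝ≥0∞) + 1)⁻¹ + 2 * C := by
      gcongr with n _
      · exact h.lintegral_ratio_le n
      · exact h.lintegral_zero_le
    _ = ENNReal.ofReal (2 * (C.toReal * ∑ n ∈ Finset.range N, ((n : ℝ) + 1)⁻¹)
          + 2 * C.toReal) := by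
      have hn (n : ℕ) : ENNReal.ofReal ((n : ℝ) + 1)⁻¹ = ((n : ℝ≥0∞) + 1)⁻¹ := by
        rw [ENNReal.ofReal_inv_of_pos (by positivity), ENNReal.ofReal_add (by positivity)
          (by norm_num), ENNReal.ofReal_natCast, ENNReal.ofReal_one]
      have hsum : 0 ≤ ∑ n ∈ Finset.range N, ((n : ℝ) + 1)⁻¹ :=
        Finset.sum_nonneg fun n _ => by positivity
      have hC0 : 0 ≤ C.toReal := ENNReal.toReal_nonneg
      rw [ENNReal.ofReal_add (mul_nonneg zero_le_two (mul_nonneg hC0 hsum))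
        (mul_nonneg zero_le_two hC0), ENNReal.ofReal_mul zero_le_two,
        ENNReal.ofReal_mul zero_le_two, ENNReal.ofReal_mul hC0, ← hC,
        ENNReal.ofReal_sum_of_nonneg fun n _ => by positivity, ← Finset.mul_sum]
      simp only [hn, ENNReal.ofReal_ofNat]
    _ ≤ _ := by
      refine ENNReal.ofReal_le_ofReal ?_
      have := mul_le_mul_of_nonneg_left hharm (show 0 ≤ C.toReal by positivity)
      linarith

theorem tendsto_abs_log_nhdsGT_zero : Tendsto (fun x : ℝ => |Real.log x|) (𝓝[>] 0) atTop :=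
  tendsto_abs_atBot_atTop.comp Real.tendsto_log_nhdsGT_zero

theorem tendsto_log_add_mul_log_div (a b : ℝ) :
    Tendsto (fun y : ℝ => (a + b * Real.log y) / y) atTop (𝓝 0) := by
  have h1 : Tendsto (fun y : ℝ => a / y) atTop (𝓝 0) := tendsto_const_nhds.div_atTop tendsto_id
  have h2 := (Real.isLittleO_log_id_atTop.tendsto_div_nhds_zero).const_mul b
  have := h1.add h2
  rw [mul_zero, add_zero] at this
  refine this.congr fun y => ?_
  simp only [id]
  ring

theorem MomentBounds.integrable_Q {χ : Measure RadialGraph} {C : ℝ≥0∞} (h : MomentBounds χ C)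
    {x : ℝ} (hx : x ∈ Set.Ioo (0 : ℝ) 1) : Integrable (fun G : RadialGraph => G.Q x) χ := by
  have := h.isProbabilityMeasure
  refine Integrable.of_bound (RadialGraph.measurable_Q hx).aestronglyMeasurable (2 / x)
    (Eventually.of_forall fun G => ?_)
  rw [Real.norm_of_nonneg (zero_le_one.trans (G.one_le_Q hx))]
  exact G.Q_le hx

theorem MomentBounds.one_le_integral_Q {χ : Measure RadialGraph} {C : ℝ≥0∞} (h : MomentBounds χ C)
    {x : ℝ} (hx : x ∈ Set.Ioo (0 : ℝ) 1) : 1 ≤ ∫ G : RadialGraph, G.Q x ∂χ := by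
  have := h.isProbabilityMeasure
  have h1 := integral_mono (integrable_const (1 : ℝ)) (h.integrable_Q hx)
    fun G => RadialGraph.one_le_Q G hx
  simpa using h1

theorem MomentBounds.integral_Q_le {χ : Measure RadialGraph} {C : ℝ≥0∞} (h : MomentBounds χ C)
    {x : ℝ} (hx : x ∈ Set.Ioo (0 : ℝ) 1) (hx' : x ≤ 1 / 2) :
    ∫ G : RadialGraph, G.Q x ∂χ ≤ 2 * C.toReal * (3 + |Real.log x|) := by
  rw [integral_eq_lintegral_of_nonneg_ae
    (Eventually.of_forall fun G => zero_le_one.trans (G.one_le_Q hx))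
    (RadialGraph.measurable_Q hx).aestronglyMeasurable]
  exact ENNReal.toReal_le_of_le_ofReal (by positivity) (h.lintegral_Q_le hx hx')

theorem MomentBounds.hasSpectralDimension_integral {χ : Measure RadialGraph} {C : ℝ≥0∞}
    (h : MomentBounds χ C) :
    HasSpectralDimension (fun x : ℝ => ∫ G : RadialGraph, G.Q x ∂χ) 2 := by
  refine ⟨0, ?_, by norm_num⟩
  -- The factor `4` comes from `3 + y ≤ 4 * y` for `y = |log x| ≥ 1`.
  have h1 := (tendsto_log_add_mul_log_div (Real.log (2 * C.toReal * 4)) 1).comp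
    tendsto_abs_log_nhdsGT_zero
  have hx : ∀ᶠ x : ℝ in 𝓝[>] 0, x ∈ Set.Ioo (0 : ℝ) (1 / 2) :=
    Ioo_mem_nhdsGT (by norm_num)
  refine tendsto_of_tendsto_of_tendsto_of_le_of_le' tendsto_const_nhds h1 ?_ ?_
  · filter_upwards [hx] with x hx
    exact div_nonneg (Real.log_nonneg (h.one_le_integral_Q ⟨hx.1, by linarith [hx.2]⟩))
      (abs_nonneg _)
  · filter_upwards [hx, tendsto_abs_log_nhdsGT_zero.eventually_ge_atTop 1] with x hx hl
    have hx1 : x ∈ Set.Ioo (0 : ℝ) 1 := ⟨hx.1, by linarith [hx.2]⟩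
    have h2 := h.one_le_integral_Q hx1
    have h3 := h.integral_Q_le hx1 hx.2.le
    -- Otherwise the upper bound would contradict `1 ≤ ∫ Q`.
    have hC : 0 < C.toReal := by
      by_contra hC
      have : C.toReal = 0 := le_antisymm (not_lt.1 hC) ENNReal.toReal_nonneg
      rw [this] at h3
      linarith
    simp only [Function.comp_apply, one_mul]
    gcongr
    rw [← Real.log_mul (by positivity) (by positivity)]
    refine Real.log_le_log (by linarith) (h3.trans ?_)
    rw [mul_assoc _ (4 : ℝ)]
    gcongr
    linarith

/-- At these points the mean of `Q` is at most `8 * C * (k + 1)`. The cubic weight makes the sum of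
the means converge, so the weighted series is almost surely finite and bounds each of its terms. -/
theorem MomentBounds.ae_exists_Q_le {χ : Measure RadialGraph} {C : ℝ≥0∞} (h : MomentBounds χ C) :
    ∀ᵐ G ∂χ, ∃ S : ℝ, ∀ k : ℕ, RadialGraph.Q G (Real.exp (-((k : ℝ) + 1))) ≤ S * (k + 1) ^ 3 := by
  have hx (k : ℕ) : Real.exp (-((k : ℝ) + 1)) ∈ Set.Ioo (0 : ℝ) 1 :=
    ⟨Real.exp_pos _, by
      rw [Real.exp_lt_one_iff]
      have : (0 : ℝ) ≤ k := k.cast_nonneg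
      linarith⟩
  have hx' (k : ℕ) : Real.exp (-((k : ℝ) + 1)) ≤ 1 / 2 := by
    rw [Real.exp_neg, one_div]
    refine inv_anti₀ (by norm_num) ?_
    have := Real.add_one_le_exp ((k : ℝ) + 1)
    have : (0 : ℝ) ≤ k := k.cast_nonneg
    linarith
  let F (k : ℕ) (G : RadialGraph) : ℝ≥0∞ :=
    ENNReal.ofReal (((k : ℝ) + 1) ^ 3)⁻¹
      * ENNReal.ofReal (RadialGraph.Q G (Real.exp (-((k : ℝ) + 1))))
  have hFm (k : ℕ) : Measurable (F k) :=
    (RadialGraph.measurable_Q (hx k)).ennreal_ofReal.const_mul _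
  have hsum : Summable fun k : ℕ => 8 * C.toReal * (((k : ℝ) + 1) ^ 2)⁻¹ := by
    refine Summable.mul_left _ ?_
    have := (summable_nat_add_iff 1).2 (Real.summable_nat_pow_inv.2 (by norm_num : 1 < 2))
    simpa using this
  have hF : ∫⁻ G, ∑' k, F k G ∂χ ≠ ∞ := by
    rw [lintegral_tsum fun k => (hFm k).aemeasurable]
    refine ne_top_of_le_ne_top ?_ (ENNReal.tsum_le_tsum
      (g := fun k : ℕ => ENNReal.ofReal (8 * C.toReal * (((k : ℝ) + 1) ^ 2)⁻¹)) fun k => ?_)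
    · rw [← ENNReal.ofReal_tsum_of_nonneg (fun k => by positivity) hsum]
      exact ENNReal.ofReal_ne_top
    · rw [lintegral_const_mul _ (RadialGraph.measurable_Q (hx k)).ennreal_ofReal]
      refine (mul_le_mul_right (h.lintegral_Q_le (hx k) (hx' k)) _).trans ?_
      rw [← ENNReal.ofReal_mul (by positivity), Real.log_exp]
      refine ENNReal.ofReal_le_ofReal ?_
      have hk : (0 : ℝ) < (k : ℝ) + 1 := by positivity
      rw [abs_neg, abs_of_pos hk]
      calc _ ≤ (((k : ℝ) + 1) ^ 3)⁻¹ * (2 * C.toReal * (4 * (k + 1))) := by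
            gcongr
            linarith
        _ = _ := by
          field_simp
          ring
  filter_upwards [ae_lt_top (Measurable.tsum hFm) hF] with G hG
  refine ⟨(∑' k, F k G).toReal, fun k => ?_⟩
  have h1 : F k G ≤ ENNReal.ofReal (∑' k, F k G).toReal := by
    rw [ENNReal.ofReal_toReal hG.ne]
    exact ENNReal.le_tsum k
  have hk : (0 : ℝ) < ((k : ℝ) + 1) ^ 3 := by positivity
  simp only [F] at h1
  rw [← ENNReal.ofReal_mul (by positivity), ENNReal.ofReal_le_ofReal_iff (by positivity),
    inv_mul_le_iff₀ hk, mul_comm] at h1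
  exact h1

/-- The limit is assumed to exist, so it can be computed along one sequence; there `log Q` lies
between `0` and `log S + 3 * log (k + 1)`, while `|log x| = k + 1`. -/
theorem hasSpectralDimension_two_of_Q_le {G : RadialGraph} {S d : ℝ}
    (hS : ∀ k : ℕ, G.Q (Real.exp (-((k : ℝ) + 1))) ≤ S * (k + 1) ^ 3)
    (hd : HasSpectralDimension G.Q d) : HasSpectralDimension G.Q 2 := by
  obtain ⟨α, hα, -⟩ := hd
  suffices h0 : α = 0 by
    subst h0
    exact ⟨0, hα, by norm_num⟩
  have hy : Tendsto (fun k : ℕ => (k : ℝ) + 1) atTop atTop :=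
    tendsto_atTop_add_const_right _ _ tendsto_natCast_atTop_atTop
  have hx : Tendsto (fun k : ℕ => Real.exp (-((k : ℝ) + 1))) atTop (𝓝[>] 0) :=
    tendsto_nhdsWithin_iff.2 ⟨Real.tendsto_exp_neg_atTop_nhds_zero.comp hy,
      Eventually.of_forall fun k => Real.exp_pos _⟩
  refine tendsto_nhds_unique (hα.comp hx) ?_
  refine tendsto_of_tendsto_of_tendsto_of_le_of_le tendsto_const_nhds
    ((tendsto_log_add_mul_log_div (Real.log S) 3).comp hy) (fun k => ?_) fun k => ?_
  all_goals
    have hk : (0 : ℝ) < (k : ℝ) + 1 := by positivity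
    have hQ := G.one_le_Q (x := Real.exp (-((k : ℝ) + 1))) ⟨Real.exp_pos _, by
      rw [Real.exp_lt_one_iff]
      linarith⟩
    simp only [Function.comp_apply, Real.log_exp, abs_neg, abs_of_pos hk]
  · exact div_nonneg (Real.log_nonneg hQ) hk.le
  · have hSpos : 0 < S := by
      by_contra hSn
      have := mul_nonpos_of_nonpos_of_nonneg (not_lt.1 hSn) (pow_nonneg hk.le 3)
      linarith [hS k]
    gcongr
    have h3 : (3 : ℝ) * Real.log ((k : ℝ) + 1) = Real.log (((k : ℝ) + 1) ^ 3) := by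
      rw [Real.log_pow]
      norm_num
    rw [h3, ← Real.log_mul hSpos.ne' (by positivity)]
    exact Real.log_le_log (by linarith) (hS k)

end PlanarTree

theorem theorem6 :
    (∃! μ : Measure PlanarTree, PlanarTree.IsUniformInfinitePlanarTree μ) ∧
    ∀ μ : Measure PlanarTree, PlanarTree.IsUniformInfinitePlanarTree μ →
      ∀ χ : Measure RadialGraph, (χ = chiR μ ∨ χ = chiR' μ) →
        IsProbabilityMeasure χ ∧
        (∀ x ∈ Set.Ioo (0 : ℝ) 1, Integrable (fun G : RadialGraph => G.Q x) χ) ∧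
        HasSpectralDimension (fun x : ℝ => ∫ G : RadialGraph, G.Q x ∂χ) 2 ∧
        ((∀ᵐ G ∂χ, ∃ d : ℝ, HasSpectralDimension (RadialGraph.Q G) d) →
          ∀ᵐ G ∂χ, HasSpectralDimension (RadialGraph.Q G) 2) := by
  refine ⟨PlanarTree.existsUnique_isUniformInfinitePlanarTree, fun μ hμ χ hχ => ?_⟩
  rw [hμ.eq_survivingTree] at hχ
  obtain ⟨C, h⟩ := PlanarTree.exists_momentBounds hχ
  refine ⟨h.isProbabilityMeasure, fun x hx => h.integrable_Q hx, h.hasSpectralDimension_integral,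
    fun hd => ?_⟩
  filter_upwards [hd, h.ae_exists_Q_le] with G ⟨d, hd⟩ ⟨S, hS⟩
  exact PlanarTree.hasSpectralDimension_two_of_Q_le hS hd
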